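/- Conventions. For complex Hilbert spaces $H,K$, $B(H;K)$ is the space of bounded operators, $\|A\|_{\mathcal S_1}=\sum_{e}\langle |A|e,e\rangle$ (sum over an orthonormal basis of $H$, $|A|=(A^*A)^{1/2}$), and $\mathcal S_1(H;K)=\{A\in B(H;K):\|A\|_{\mathcal S_1}<\infty\}$. A projection-valued measure $Q$ on $(\Xi,\mathscr G)$ acting on $K$ assigns to each $G\in\mathscr G$ an orthogonal projection $Q(G)\in B(K)$, with $Q(\Xi)=1$ and countable additivity in the weak operator topology; $\|\psi\|_{L^\infty(Q)}=\inf\{c\ge 0: Q(|\psi|>c)=0\}$, and for measurable $\psi$ with $\|\psi\|_{L^\infty(Q)}<\infty$, $Q(\psi)\in B(K)$ is the operator with $\langle Q(\psi)h,h'\rangle=\int\psi\,d\langle Q(\cdot)h,h'\rangle$ for all $h,h'\in K$. The upper integral of $h:\Sigma\to[0,\infty]$ is $\overline{\int_\Sigma} h\,d\rho=\inf\{\int_\Sigma\tilde h\,d\rho:\tilde h \text{ measurable},\ h\le\tilde h\ \rho\text{-a.e.}\}$. A map $f:\Sigma\to V$ into a Hausdorff locally convex space is Gel'fand–Pettis integrable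 if for every $\ell\in V^*$ the function $\ell\circ f$ is measurable and $\rho$-integrable, and for every measurable $S\subseteq\Sigma$ there is $\int_S f\,d\rho\in V$ with $\ell(\int_S f\,d\rho)=\int_S \ell\circ f\,d\rho$ for all $\ell\in V^*$; $\int_S f\,d\rho$ is its Gel'fand–Pettis integral over $S$. **Theorem 4.11.** Let $k\in\mathbb N$ and, for $1\le j\le k+1$, let $P_j$ be a projection-valued measure on a measurable space $(\Omega_j,\mathscr F_j)$ acting on a complex Hilbert space $H_j$. Let $P=P_1\otimes\cdots\otimes P_{k+1}$ be the tensor product projection-valued measure on $\Omega=\Omega_1\times\cdots\times\Omega_{k+1}$, acting on the Hilbert space tensor product of the $H_j$ (the unique one with $P(G_1\times\cdots\times G_{k+1})=P_1(G_1)\otimes\cdots\otimes P_{k+1}(G_{k+1})$ for all $G_j\in\mathscr F_j$). Let $\varphi:\Omega\to\mathbb C$ have an integral projective decomposition $(\Sigma,\rho,\varphi_1,\dots,\varphi_{k+1})$, that is: $(\Sigma,\mathscr H,\rho)$ is a $\sigma$-finite measure space; $\varphi_j:\Omega_j\times\Sigma\to\mathbb C$ are measurable with $\|\varphi_j(\cdot,\sigma)\|_{L^\infty(P_j)}<\infty$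 for all $j$ and all $\sigma\in\Sigma$; $$\overline{\int_\Sigma}\ \|\varphi_1(\cdot,\sigma)\|_{L^\infty(P_1)}\cdots\|\varphi_{k+1}(\cdot,\sigma)\|_{L^\infty(P_{k+1})}\,\rho(d\sigma)<\infty;$$ and $\varphi(\omega_1,\dots,\omega_{k+1})=\int_\Sigma\varphi_1(\omega_1,\sigma)\cdots\varphi_{k+1}(\omega_{k+1},\sigma)\,\rho(d\sigma)$ for $P$-almost every $(\omega_1,\dots,\omega_{k+1})$. Let $b_j\in B(H_{j+1};H_j)$ for $1\le j\le k$, and put $$F(\sigma)=P_1(\varphi_1(\cdot,\sigma))\,b_1\cdots P_k(\varphi_k(\cdot,\sigma))\,b_k\,P_{k+1}(\varphi_{k+1}(\cdot,\sigma))\in B(H_{k+1};H_1).$$ Let $I^{\boldsymbol P}(\Sigma,\rho,\varphi_1,\dots,\varphi_{k+1})[b]\in B(H_{k+1};H_1)$ be the multiple operator integral of this decomposition, i.e. the pointwise Pettis integral of $F$: the operator $T$ with $\langle Th,h'\rangle=\int_\Sigma\langle F(\sigma)h,h'\rangle\,\rho(d\sigma)$ for all $h\in H_{k+1}$, $h'\in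 H_1$. If $b_j\in\mathcal S_1(H_{j+1};H_j)$ for some $j\in\{1,\dots,k\}$, then $F(\sigma)\in\mathcal S_1(H_{k+1};H_1)$ for every $\sigma\in\Sigma$, the map $F$ is Gel'fand–Pettis integrable as a map $\Sigma\to(\mathcal S_1(H_{k+1};H_1),\|\cdot\|_{\mathcal S_1})$, $I^{\boldsymbol P}(\Sigma,\rho,\varphi_1,\dots,\varphi_{k+1})[b]\in\mathcal S_1(H_{k+1};H_1)$, and the Gel'fand–Pettis integral of $F$ over $\Sigma$ is $I^{\boldsymbol P}(\Sigma,\rho,\varphi_1,\dots,\varphi_{k+1})[b]$. -/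

import Mathlib

open MeasureTheory ContinuousLinearMap
open scoped ENNReal InnerProductSpace InnerProduct

noncomputable section

namespace OpInt

section TraceClass

theorem inner_map_eq_of_nonneg {E : Type*} [NormedAddCommGroup E] [InnerProductSpace ℂ E]
    {T : E →L[ℂ] E} (hT : 0 ≤ T) (x y : E) :
    ⟪T x, y⟫_ℂ = ⟪x, T y⟫_ℂ :=
  ((nonneg_iff_isPositive T).1 hT).isSymmetric x y

variable {E : Type*} [NormedAddCommGroup E] [InnerProductSpace ℂ E] [CompleteSpace E]
variable {F : Type*} [NormedAddCommGroup F] [InnerProductSpace ℂ F] [CompleteSpace F]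

variable (E) in
/-- The index set of a fixed orthonormal basis of the Hilbert space `E`. -/
def stdIdx : Set E := (exists_hilbertBasis ℂ E).choose

variable (E) in
/-- A fixed orthonormal basis of the Hilbert space `E`. -/
def stdBasis : HilbertBasis (stdIdx E) ℂ E := (exists_hilbertBasis ℂ E).choose_spec.choose

/-- The absolute value `|A| = (A* A)^{1/2}` of `A : E → F`, by functional calculus. -/
def absOp (A : E →L[ℂ] F) : E →L[ℂ] E := CFC.sqrt (A† ∘L A)

/-- The Schatten 1-norm `∑ₑ ⟨|A| e, e⟩ ∈ [0, ∞]`, the sum running over an orthonormal basis of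
`E` (the value does not depend on the basis). -/
def traceNorm (A : E →L[ℂ] F) : ℝ≥0∞ :=
  ∑' e, ENNReal.ofReal (RCLike.re ⟪absOp A (stdBasis E e), stdBasis E e⟫_ℂ)

theorem adjoint_comp_self_nonneg (A : E →L[ℂ] F) : 0 ≤ A† ∘L A :=
  (nonneg_iff_isPositive _).2 (isPositive_adjoint_comp_self A)

theorem absOp_nonneg (A : E →L[ℂ] F) : 0 ≤ absOp A := CFC.sqrt_nonneg _

theorem absOp_mul_absOp (A : E →L[ℂ] F) : absOp A * absOp A = A† ∘L A :=
  CFC.sqrt_mul_sqrt_self _ (adjoint_comp_self_nonneg A)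

theorem inner_absOp_absOp (A : E →L[ℂ] F) (x y : E) :
    ⟪absOp A x, absOp A y⟫_ℂ = ⟪A x, A y⟫_ℂ := by
  rw [inner_map_eq_of_nonneg (absOp_nonneg A), ← mul_apply_eq_comp, absOp_mul_absOp, comp_apply,
    adjoint_inner_right]

theorem norm_absOp_apply (A : E →L[ℂ] F) (x : E) : ‖absOp A x‖ = ‖A x‖ := by
  have h := inner_absOp_absOp A x x
  rw [inner_self_eq_norm_sq_to_K, inner_self_eq_norm_sq_to_K] at h
  have h2 : ‖absOp A x‖ ^ 2 = ‖A x‖ ^ 2 := by exact_mod_cast h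
  exact (sq_eq_sq₀ (norm_nonneg _) (norm_nonneg _)).1 h2

/-- Approximate polar decomposition. -/
theorem exists_contraction (A : E →L[ℂ] F) {ε : ℝ} (hε : 0 < ε) :
    ∃ W : E →L[ℂ] F, (∀ x, ‖W x‖ ≤ ‖x‖) ∧
      (∀ x, A x = W (absOp A x) + (ε : ℂ) • W x) ∧
      (∀ x, RCLike.re ⟪absOp A x, x⟫_ℂ ≤ ‖⟪W x, A x⟫_ℂ‖ + ε * ‖x‖ ^ 2) := by
  set R := absOp A with hR
  have hRp : R.IsPositive := (nonneg_iff_isPositive _).1 (absOp_nonneg A)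
  have hlow : ∀ x, ‖R x‖ ≤ ‖(R + (ε : ℂ) • (1 : E →L[ℂ] E)) x‖ := by
    intro x
    have h1 : 0 ≤ RCLike.re ⟪R x, x⟫_ℂ := hRp.re_inner_nonneg_left x
    have h2 := @norm_add_sq ℂ _ _ _ _ (R x) ((ε : ℂ) • x)
    rw [inner_smul_right] at h2
    have h3 : RCLike.re ((ε : ℂ) * ⟪R x, x⟫_ℂ) = ε * RCLike.re ⟪R x, x⟫_ℂ := by
      simp
    rw [h3] at h2
    have : (R + (ε : ℂ) • (1 : E →L[ℂ] E)) x = R x + (ε : ℂ) • x := by simp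
    rw [this]
    refine le_of_sq_le_sq ?_ (norm_nonneg _)
    nlinarith [mul_nonneg hε.le h1, sq_nonneg ‖(ε : ℂ) • x‖]
  have hu : IsUnit (R + (ε : ℂ) • (1 : E →L[ℂ] E)) := by
    refine isUnit_of_forall_le_norm_inner_map _ (c := ⟨ε, hε.le⟩) hε fun x ↦ ?_
    have h1 : 0 ≤ RCLike.re ⟪R x, x⟫_ℂ := hRp.re_inner_nonneg_left x
    refine le_trans ?_ (RCLike.re_le_norm _)
    have h3 : RCLike.re ⟪(R + (ε : ℂ) • (1 : E →L[ℂ] E)) x, x⟫_ℂ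
        = RCLike.re ⟪R x, x⟫_ℂ + ε * ‖x‖ ^ 2 := by
      simp [inner_add_left, inner_smul_left, inner_self_eq_norm_sq_to_K, ← Complex.ofReal_pow]
    rw [h3]
    change ‖x‖ ^ 2 * ε ≤ _
    linarith
  obtain ⟨u, hu⟩ := hu
  have hux : ∀ x, (R + (ε : ℂ) • (1 : E →L[ℂ] E)) ((↑u⁻¹ : E →L[ℂ] E) x) = x := fun x => by
    rw [← hu, ← mul_apply_eq_comp, Units.mul_inv]; rfl
  have hRu : ∀ x, ‖R ((↑u⁻¹ : E →L[ℂ] E) x)‖ ≤ ‖x‖ := fun x =>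
    (hlow _).trans_eq (by rw [hux])
  refine ⟨A ∘L (↑u⁻¹ : E →L[ℂ] E), fun x => ?_, fun x => ?_, fun x => ?_⟩
  · rw [comp_apply, ← norm_absOp_apply]
    exact hRu x
  · have h : (↑u⁻¹ : E →L[ℂ] E) ((R + (ε : ℂ) • (1 : E →L[ℂ] E)) x) = x := by
      rw [← hu, ← mul_apply_eq_comp, Units.inv_mul]; rfl
    rw [comp_apply, comp_apply, ← map_smul, ← map_smul, ← map_add, ← map_add]
    conv_lhs => rw [← h]
    simp
  · set y := (↑u⁻¹ : E →L[ℂ] E) x with hy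
    have hx : R y = x - (ε : ℂ) • y := by
      have := hux x
      rw [← hy] at this
      rw [eq_sub_iff_add_eq]
      simpa using this
    have h1 : ⟪A y, A x⟫_ℂ = ⟪x, R x⟫_ℂ - (ε : ℂ) * ⟪R y, x⟫_ℂ := by
      rw [← inner_absOp_absOp, ← hR, inner_map_eq_of_nonneg (absOp_nonneg A) y x, ← hR]
      conv_lhs => rw [hx]
      rw [inner_sub_left, inner_smul_left]
      simp
    have h2 : ‖(ε : ℂ) * ⟪R y, x⟫_ℂ‖ ≤ ε * ‖x‖ ^ 2 := by
      rw [norm_mul, Complex.norm_real, Real.norm_of_nonneg hε.le]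
      refine mul_le_mul_of_nonneg_left ?_ hε.le
      refine (norm_inner_le_norm _ _).trans ?_
      nlinarith [hRu x, norm_nonneg x]
    have h3 : ⟪R x, x⟫_ℂ = ⟪A y, A x⟫_ℂ + (ε : ℂ) * ⟪R y, x⟫_ℂ := by
      rw [h1, inner_map_eq_of_nonneg (absOp_nonneg A) x x]; ring
    rw [comp_apply, h3]
    refine (RCLike.re_le_norm _).trans ((norm_add_le _ _).trans ?_)
    gcongr

theorem parseval_stdBasis (x : E) :
    ENNReal.ofReal (‖x‖ ^ 2) = ∑' e, ENNReal.ofReal (‖⟪stdBasis E e, x⟫_ℂ‖ ^ 2) := by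
  have h := (stdBasis E).hasSum_inner_mul_inner x x
  have h2 : HasSum (fun e => ‖⟪stdBasis E e, x⟫_ℂ‖ ^ 2) (‖x‖ ^ 2) := by
    have h3 := RCLike.hasSum_re ℂ h
    rw [inner_self_eq_norm_sq] at h3
    refine h3.congr_fun ?_ 
    intro e
    rw [← inner_conj_symm x, RCLike.conj_mul]
    norm_cast
  rw [← h2.tsum_eq, ENNReal.ofReal_tsum_of_nonneg (fun _ => sq_nonneg _) h2.summable]

theorem tsum_norm_sq_eq (T : E →L[ℂ] F) :
    ∑' e, ENNReal.ofReal (‖T (stdBasis E e)‖ ^ 2) =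
      ∑' f, ENNReal.ofReal (‖adjoint T (stdBasis F f)‖ ^ 2) := by
  simp_rw [fun e => parseval_stdBasis (T (stdBasis E e)),
    fun f => parseval_stdBasis (adjoint T (stdBasis F f))]
  rw [ENNReal.tsum_comm]
  refine tsum_congr fun f => tsum_congr fun e => ?_
  rw [adjoint_inner_right, ← inner_conj_symm, RCLike.norm_conj]

theorem inner_self_of_nonneg {S : E →L[ℂ] E} (hS : 0 ≤ S) (x : E) :
    RCLike.re ⟪S (S x), x⟫_ℂ = ‖S x‖ ^ 2 := by
  rw [inner_map_eq_of_nonneg hS, inner_self_eq_norm_sq]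

theorem sqrt_sqrt_apply {R : E →L[ℂ] E} (hR : 0 ≤ R) (x : E) :
    CFC.sqrt R (CFC.sqrt R x) = R x :=
  (mul_apply_eq_comp _ _ x).symm.trans
    (congrArg (fun T : E →L[ℂ] E => T x) (CFC.sqrt_mul_sqrt_self R hR))

theorem inner_absOp_self (A : E →L[ℂ] F) (x : E) :
    RCLike.re ⟪absOp A x, x⟫_ℂ = ‖CFC.sqrt (absOp A) x‖ ^ 2 := by
  have h := inner_self_of_nonneg (CFC.sqrt_nonneg (absOp A)) x
  have h2 := sqrt_sqrt_apply (absOp_nonneg A) x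
  exact (congrArg (fun y => RCLike.re ⟪y, x⟫_ℂ) h2).symm.trans h

theorem traceNorm_eq_tsum_sqrt (A : E →L[ℂ] F) :
    traceNorm A = ∑' e, ENNReal.ofReal (‖CFC.sqrt (absOp A) (stdBasis E e)‖ ^ 2) := by
  simp only [traceNorm, inner_absOp_self]

theorem tsum_norm_sq_comp_le (S C : E →L[ℂ] E) (hS : 0 ≤ S) (hC : ‖C‖ ≤ 1) :
    ∑' e, ENNReal.ofReal (‖S (C (stdBasis E e))‖ ^ 2) ≤
      ∑' e, ENNReal.ofReal (‖S (stdBasis E e)‖ ^ 2) := by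
  have h := tsum_norm_sq_eq (S ∘L C)
  simp only [comp_apply] at h
  rw [h]
  refine ENNReal.tsum_le_tsum fun e => ENNReal.ofReal_le_ofReal ?_
  have hS' : adjoint S = S := ((nonneg_iff_isPositive S).1 hS).isSelfAdjoint
  rw [adjoint_comp, comp_apply, hS']
  have : ‖adjoint C (S (stdBasis E e))‖ ≤ ‖S (stdBasis E e)‖ := by
    refine (le_opNorm _ _).trans ?_
    rw [LinearIsometryEquiv.norm_map]
    exact mul_le_of_le_one_left (norm_nonneg _) hC
  gcongr

theorem le_of_forall_le_add_card (n : ℕ) {a b : ℝ≥0∞}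
    (h : ∀ ε : ℝ, 0 < ε → a ≤ b + n * ENNReal.ofReal ε) : a ≤ b := by
  refine ENNReal.le_of_forall_pos_le_add fun δ hδ _ => ?_
  have hn : (0 : ℝ) < n + 1 := by positivity
  refine (h (δ / (n + 1)) (by positivity)).trans ?_
  gcongr
  rw [← ENNReal.ofReal_natCast, ← ENNReal.ofReal_mul (by positivity),
    ← ENNReal.ofReal_coe_nnreal]
  refine ENNReal.ofReal_le_ofReal ?_
  rw [mul_div_assoc', div_le_iff₀ hn]
  nlinarith [δ.coe_nonneg]

theorem norm_stdBasis (e : stdIdx E) : ‖stdBasis E e‖ = 1 :=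
  (stdBasis E).orthonormal.1 e

theorem tsum_inner_contraction_le (A W : E →L[ℂ] F) (hW : ∀ x, ‖W x‖ ≤ ‖x‖) :
    ∑' e, ENNReal.ofReal ‖⟪W (stdBasis E e), A (stdBasis E e)⟫_ℂ‖ ≤ traceNorm A := by
  rw [ENNReal.tsum_eq_iSup_sum]
  refine iSup_le fun s => le_of_forall_le_add_card s.card fun ε hε => ?_
  obtain ⟨V, hV, hA, -⟩ := exists_contraction A hε
  set S := CFC.sqrt (absOp A) with hSdef
  have hS : 0 ≤ S := CFC.sqrt_nonneg _
  have hSS : ∀ x, absOp A x = S (S x) := fun x => by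
    rw [← mul_apply_eq_comp, CFC.sqrt_mul_sqrt_self _ (absOp_nonneg A)]
  set C : E →L[ℂ] E := adjoint V ∘L W with hCdef
  have hC : ‖C‖ ≤ 1 := by
    refine (opNorm_comp_le _ _).trans ?_
    rw [LinearIsometryEquiv.norm_map]
    exact mul_le_one₀ (opNorm_le_bound _ zero_le_one fun x => by simpa using hV x)
      (norm_nonneg _) (opNorm_le_bound _ zero_le_one fun x => by simpa using hW x)
  have key : ∀ x : E, ‖x‖ = 1 →
      ‖⟪W x, A x⟫_ℂ‖ ≤ (1 / 2) * ‖S (C x)‖ ^ 2 + (1 / 2) * ‖S x‖ ^ 2 + ε := by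
    intro x hx
    have h1 : ⟪W x, A x⟫_ℂ = ⟪S (C x), S x⟫_ℂ + (ε : ℂ) * ⟪W x, V x⟫_ℂ := by
      rw [hA, inner_add_right, inner_smul_right, inner_map_eq_of_nonneg hS, ← hSS, hCdef,
        comp_apply, adjoint_inner_left]
    have h2 : ‖(ε : ℂ) * ⟪W x, V x⟫_ℂ‖ ≤ ε := by
      rw [norm_mul, Complex.norm_real, Real.norm_of_nonneg hε.le]
      refine mul_le_of_le_one_right hε.le ((norm_inner_le_norm _ _).trans ?_)
      exact mul_le_one₀ ((hW x).trans_eq hx) (norm_nonneg _) ((hV x).trans_eq hx)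
    have h3 : ‖⟪S (C x), S x⟫_ℂ‖ ≤ (1 / 2) * ‖S (C x)‖ ^ 2 + (1 / 2) * ‖S x‖ ^ 2 := by
      refine (norm_inner_le_norm _ _).trans ?_
      nlinarith [sq_nonneg (‖S (C x)‖ - ‖S x‖)]
    rw [h1]
    exact (norm_add_le _ _).trans (add_le_add h3 h2)
  have hhalf : ENNReal.ofReal (1 / 2) + ENNReal.ofReal (1 / 2) = 1 := by
    rw [← ENNReal.ofReal_add (by norm_num) (by norm_num)]; norm_num
  calc ∑ e ∈ s, ENNReal.ofReal ‖⟪W (stdBasis E e), A (stdBasis E e)⟫_ℂ‖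
      ≤ ∑ e ∈ s, (ENNReal.ofReal (1 / 2) * ENNReal.ofReal (‖S (C (stdBasis E e))‖ ^ 2)
          + ENNReal.ofReal (1 / 2) * ENNReal.ofReal (‖S (stdBasis E e)‖ ^ 2)
          + ENNReal.ofReal ε) := by
        refine Finset.sum_le_sum fun e _ => ?_
        rw [← ENNReal.ofReal_mul (by norm_num), ← ENNReal.ofReal_mul (by norm_num),
          ← ENNReal.ofReal_add (by positivity) (by positivity),
          ← ENNReal.ofReal_add (by positivity) hε.le]
        exact ENNReal.ofReal_le_ofReal (key _ (norm_stdBasis e))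
    _ = ENNReal.ofReal (1 / 2) * ∑ e ∈ s, ENNReal.ofReal (‖S (C (stdBasis E e))‖ ^ 2)
          + ENNReal.ofReal (1 / 2) * ∑ e ∈ s, ENNReal.ofReal (‖S (stdBasis E e)‖ ^ 2)
          + s.card * ENNReal.ofReal ε := by
        rw [Finset.sum_add_distrib, Finset.sum_add_distrib, Finset.mul_sum, Finset.mul_sum,
          Finset.sum_const, nsmul_eq_mul]
    _ ≤ ENNReal.ofReal (1 / 2) * traceNorm A + ENNReal.ofReal (1 / 2) * traceNorm A
          + s.card * ENNReal.ofReal ε := by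
        have h1 := (ENNReal.sum_le_tsum s).trans (tsum_norm_sq_comp_le S C hS hC)
        have h2 := ENNReal.sum_le_tsum (f := fun e => ENNReal.ofReal (‖S (stdBasis E e)‖ ^ 2)) s
        rw [hSdef, ← traceNorm_eq_tsum_sqrt] at h1 h2
        gcongr
    _ = traceNorm A + s.card * ENNReal.ofReal ε := by
        rw [← add_mul, hhalf, one_mul]

theorem traceNorm_le (A : E →L[ℂ] F) (c : ℝ≥0∞)
    (h : ∀ W : E →L[ℂ] F, (∀ x, ‖W x‖ ≤ ‖x‖) →
      ∑' e, ENNReal.ofReal ‖⟪W (stdBasis E e), A (stdBasis E e)⟫_ℂ‖ ≤ c) :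
    traceNorm A ≤ c := by
  rw [traceNorm, ENNReal.tsum_eq_iSup_sum]
  refine iSup_le fun s => le_of_forall_le_add_card s.card fun ε hε => ?_
  obtain ⟨W, hW, -, hA⟩ := exists_contraction A hε
  calc _ ≤ ∑ e ∈ s, (ENNReal.ofReal ‖⟪W (stdBasis E e), A (stdBasis E e)⟫_ℂ‖
          + ENNReal.ofReal ε) := by
        refine Finset.sum_le_sum fun e _ => ?_
        rw [← ENNReal.ofReal_add (norm_nonneg _) hε.le]
        refine ENNReal.ofReal_le_ofReal ((hA _).trans_eq ?_)
        rw [norm_stdBasis]; ring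
    _ ≤ c + s.card * ENNReal.ofReal ε := by
        rw [Finset.sum_add_distrib, Finset.sum_const, nsmul_eq_mul]
        gcongr
        exact (ENNReal.sum_le_tsum s).trans (h W hW)

theorem traceNorm_add_le (A B : E →L[ℂ] F) : traceNorm (A + B) ≤ traceNorm A + traceNorm B := by
  refine traceNorm_le _ _ fun W hW => ?_
  refine le_trans ?_ (add_le_add (tsum_inner_contraction_le A W hW)
    (tsum_inner_contraction_le B W hW))
  rw [← ENNReal.tsum_add]
  refine ENNReal.tsum_le_tsum fun e => ?_
  rw [← ENNReal.ofReal_add (norm_nonneg _) (norm_nonneg _), add_apply, inner_add_right]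
  exact ENNReal.ofReal_le_ofReal (norm_add_le _ _)

theorem traceNorm_smul_le (c : ℂ) (A : E →L[ℂ] F) :
    traceNorm (c • A) ≤ ENNReal.ofReal ‖c‖ * traceNorm A := by
  refine traceNorm_le _ _ fun W hW => ?_
  refine le_trans ?_ (mul_le_mul_right (tsum_inner_contraction_le A W hW) _)
  rw [← ENNReal.tsum_mul_left]
  refine ENNReal.tsum_le_tsum fun e => ?_
  rw [← ENNReal.ofReal_mul (norm_nonneg _), FunLike.coe_smul, Pi.smul_apply, inner_smul_right, norm_mul]

theorem traceNorm_zero : traceNorm (0 : E →L[ℂ] F) = 0 := by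
  have h := traceNorm_smul_le (0 : ℂ) (0 : E →L[ℂ] F)
  simpa using h

theorem traceNorm_eq_zero {A : E →L[ℂ] F} (h : traceNorm A = 0) : A = 0 := by
  rw [traceNorm_eq_tsum_sqrt, ENNReal.tsum_eq_zero] at h
  have h0 : ∀ e, CFC.sqrt (absOp A) (stdBasis E e) = 0 := fun e => by
    have := h e
    rw [ENNReal.ofReal_eq_zero] at this
    exact norm_eq_zero.1 (pow_eq_zero_iff two_ne_zero |>.1 (le_antisymm this (sq_nonneg _)))
  have h1 : CFC.sqrt (absOp A) = 0 := by
    refine ContinuousLinearMap.ext_on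
      (Submodule.dense_iff_topologicalClosure_eq_top.2 (stdBasis E).dense_span) ?_
    rintro _ ⟨e, rfl⟩
    simpa using h0 e
  have h2 : absOp A = 0 := by
    rw [← CFC.sqrt_mul_sqrt_self _ (absOp_nonneg A), h1, zero_mul]
  ext x
  have := norm_absOp_apply A x
  rw [h2] at this
  simpa using this.symm

variable (E F) in
/-- The linear subspace of trace class operators `E → F`, those with finite Schatten 1-norm. -/
def traceClassSubmodule : Submodule ℂ (E →L[ℂ] F) where
  carrier := {A | traceNorm A < ⊤}
  add_mem' {A B} hA hB := (traceNorm_add_le A B).trans_lt (ENNReal.add_lt_top.2 ⟨hA, hB⟩)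
  zero_mem' := by simp [traceNorm_zero]
  smul_mem' c A hA :=
    (traceNorm_smul_le c A).trans_lt (ENNReal.mul_lt_top ENNReal.ofReal_lt_top hA)

variable (E F) in
/-- The normed space `(S₁(E; F), ‖·‖_{S₁})`. It is a separate type, so that its norm and topology
are the ones given below and not those of the operator norm. -/
def TraceClass : Type _ := traceClassSubmodule E F

namespace TraceClass

instance : AddCommGroup (TraceClass E F) :=
  inferInstanceAs (AddCommGroup (traceClassSubmodule E F))

instance : Module ℂ (TraceClass E F) :=
  inferInstanceAs (Module ℂ (traceClassSubmodule E F))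

/-- A bounded operator with finite Schatten 1-norm, as an element of `S₁(E; F)`. -/
def mk (A : E →L[ℂ] F) (hA : traceNorm A < ⊤) : TraceClass E F := ⟨A, hA⟩

/-- The bounded operator underlying an element of `S₁(E; F)`. -/
def toCLM (A : TraceClass E F) : E →L[ℂ] F := A.1

/-- The norm of `S₁(E; F)` is the Schatten 1-norm. -/
instance : Norm (TraceClass E F) := ⟨fun A => (traceNorm A.toCLM).toReal⟩

theorem core : NormedSpace.Core ℂ (TraceClass E F) where
  norm_nonneg _ := ENNReal.toReal_nonneg
  norm_smul c A := by
    have hle : ∀ (c : ℂ) (A : TraceClass E F), ‖c • A‖ ≤ ‖c‖ * ‖A‖ := fun c A => by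
      have h := ENNReal.toReal_mono (ENNReal.mul_ne_top ENNReal.ofReal_ne_top A.2.ne)
        (traceNorm_smul_le c A.toCLM)
      rwa [ENNReal.toReal_mul, ENNReal.toReal_ofReal (norm_nonneg c)] at h
    refine le_antisymm (hle c A) ?_
    rcases eq_or_ne c 0 with rfl | hc
    · rw [norm_zero, zero_mul]; exact ENNReal.toReal_nonneg
    · have h := hle c⁻¹ (c • A)
      rw [smul_smul, inv_mul_cancel₀ hc, one_smul, norm_inv] at h
      rwa [inv_mul_eq_div, le_div_iff₀' (norm_pos_iff.2 hc)] at h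
  norm_triangle A B := by
    have h := ENNReal.toReal_mono (ENNReal.add_ne_top.2 ⟨A.2.ne, B.2.ne⟩)
      (traceNorm_add_le A.toCLM B.toCLM)
    exact h.trans_eq (ENNReal.toReal_add A.2.ne B.2.ne)
  norm_eq_zero_iff A := by
    refine ⟨fun h => Subtype.ext ?_, ?_⟩
    · rcases (ENNReal.toReal_eq_zero_iff _).1 h with h | h
      · exact traceNorm_eq_zero h
      · exact absurd h A.2.ne
    · rintro rfl
      exact (congrArg ENNReal.toReal (traceNorm_zero (E := E) (F := F)))

instance : NormedAddCommGroup (TraceClass E F) := NormedAddCommGroup.ofCore core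

instance : NormedSpace ℂ (TraceClass E F) := NormedSpace.ofCore core

end TraceClass

end TraceClass

section WeakIntegral

variable {S : Type*} [MeasurableSpace S]

/-- The upper integral of an arbitrary (not necessarily measurable) function `h : S → [0, ∞]`. -/
def upperIntegral (ρ : Measure S) (h : S → ℝ≥0∞) : ℝ≥0∞ :=
  ⨅ (g : S → ℝ≥0∞) (_ : Measurable g) (_ : h ≤ᵐ[ρ] g), ∫⁻ s, g s ∂ρ

variable {V : Type*} [AddCommGroup V] [Module ℂ V] [TopologicalSpace V]

/-- `v` is a weak (Gel'fand-Pettis) integral of `f` over `G`: every continuous linear functional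
of `v` is the integral over `G` of that functional of `f`. -/
def IsGelfandPettisIntegral (ρ : Measure S) (f : S → V) (G : Set S) (v : V) : Prop :=
  ∀ l : V →L[ℂ] ℂ, l v = ∫ s in G, l (f s) ∂ρ

/-- Gel'fand-Pettis (weak) integrability of a map into a topological vector space. -/
structure GelfandPettisIntegrable (ρ : Measure S) (f : S → V) : Prop where
  measurable : ∀ l : V →L[ℂ] ℂ, Measurable fun s => l (f s)
  integrable : ∀ l : V →L[ℂ] ℂ, Integrable (fun s => l (f s)) ρ
  exists_integral : ∀ G : Set S, MeasurableSet G → ∃ v, IsGelfandPettisIntegral ρ f G v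

variable {E : Type*} [NormedAddCommGroup E] [InnerProductSpace ℂ E]
variable {F : Type*} [NormedAddCommGroup F] [InnerProductSpace ℂ F]

/-- Pointwise Pettis integrability of an operator-valued map. -/
structure PettisIntegrable (ρ : Measure S) (f : S → E →L[ℂ] F) : Prop where
  measurable : ∀ (x : E) (y : F), Measurable fun s => ⟪y, f s x⟫_ℂ
  integrable : ∀ (x : E) (y : F), Integrable (fun s => ⟪y, f s x⟫_ℂ) ρ

/-- `T` is the pointwise Pettis integral of `f`. Such a `T` is unique, and on Hilbert spaces it
exists for every pointwise Pettis integrable `f`. -/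
def IsPettisIntegral (ρ : Measure S) (f : S → E →L[ℂ] F) (T : E →L[ℂ] F) : Prop :=
  PettisIntegrable ρ f ∧ ∀ (x : E) (y : F), ⟪y, T x⟫_ℂ = ∫ s, ⟪y, f s x⟫_ℂ ∂ρ

open Classical in
/-- The pointwise Pettis integral of `f` over the whole space (`0` if `f` is not integrable). -/
def pettisIntegral (ρ : Measure S) (f : S → E →L[ℂ] F) : E →L[ℂ] F :=
  if h : ∃ T, IsPettisIntegral ρ f T then h.choose else 0

end WeakIntegral

section ProjValuedMeasure

/-- A projection-valued measure on `Ω` with values in `B(E)`: orthogonal projections, `P(Ω) = 1`,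
and countable additivity in the weak operator topology. Only the values on measurable sets are
constrained, and only these are ever used. -/
structure ProjValuedMeasure (Ω : Type*) [MeasurableSpace Ω] (E : Type*) [NormedAddCommGroup E]
    [InnerProductSpace ℂ E] [CompleteSpace E] where
  toFun : Set Ω → E →L[ℂ] E
  isStarProjection : ∀ G, MeasurableSet G → IsStarProjection (toFun G)
  map_univ : toFun Set.univ = 1
  hasSum_iUnion : ∀ G : ℕ → Set Ω, (∀ n, MeasurableSet (G n)) →
    Pairwise (fun m n => Disjoint (G m) (G n)) → ∀ x y : E,
      HasSum (fun n => ⟪y, toFun (G n) x⟫_ℂ) ⟪y, toFun (⋃ n, G n) x⟫_ℂ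

namespace ProjValuedMeasure

variable {Ω : Type*} [MeasurableSpace Ω]
variable {E : Type*} [NormedAddCommGroup E] [InnerProductSpace ℂ E] [CompleteSpace E]

/-- `p` holds `P`-almost everywhere: it holds off some measurable set `N` with `P(N) = 0`. -/
def AE (P : ProjValuedMeasure Ω E) (p : Ω → Prop) : Prop :=
  ∃ N, MeasurableSet N ∧ P.toFun N = 0 ∧ ∀ ω, ω ∉ N → p ω

/-- The `P`-essential supremum `inf {c ≥ 0 : P(|φ| > c) = 0} ∈ [0, ∞]` of `|φ|`. A measurable `φ`
represents an element of `L^∞(P)` if and only if this is finite. -/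
def essNorm (P : ProjValuedMeasure Ω E) (φ : Ω → ℂ) : ℝ≥0∞ :=
  sInf {c | P.toFun {ω | c < ‖φ ω‖ₑ} = 0}

theorem map_empty (P : ProjValuedMeasure Ω E) : P.toFun ∅ = 0 := by
  ext x
  refine ext_inner_left ℂ fun y => ?_
  have h := P.hasSum_iUnion (fun _ => ∅) (fun _ => MeasurableSet.empty)
    (fun _ _ _ => Set.disjoint_empty _) x y
  have h0 := (summable_const_iff _).1 h.summable
  simpa using h0

theorem re_inner_nonneg (P : ProjValuedMeasure Ω E) {G : Set Ω} (hG : MeasurableSet G) (x : E) :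
    0 ≤ RCLike.re ⟪x, P.toFun G x⟫_ℂ :=
  ((nonneg_iff_isPositive _).1 (P.isStarProjection G hG).nonneg).re_inner_nonneg_right x

/-- The positive measure `P_{x,x}(G) = ⟨P(G) x, x⟩`. -/
def diag (P : ProjValuedMeasure Ω E) (x : E) : Measure Ω :=
  Measure.ofMeasurable (fun G _ => ENNReal.ofReal (RCLike.re ⟪x, P.toFun G x⟫_ℂ))
    (by simp [P.map_empty])
    (fun G hG hd => by
      have h := RCLike.hasSum_re ℂ (P.hasSum_iUnion G hG hd x x)
      rw [← h.tsum_eq,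
        ENNReal.ofReal_tsum_of_nonneg (fun n => P.re_inner_nonneg (hG n) x) h.summable])

/-- `T = ∫ φ dP`. By polarization it is equivalent to demand `⟨T x, y⟩ = ∫ φ dP_{x,y}` for all
`x, y`, where `P_{x,y}(G) = ⟨P(G) x, y⟩`. Such a `T` is unique, and it exists whenever `φ` is
measurable and `P`-essentially bounded. -/
def IsIntegral (P : ProjValuedMeasure Ω E) (φ : Ω → ℂ) (T : E →L[ℂ] E) : Prop :=
  ∀ x : E, Integrable φ (P.diag x) ∧ ⟪x, T x⟫_ℂ = ∫ ω, φ ω ∂(P.diag x)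

open Classical in
/-- The integral `P(φ) = ∫ φ dP ∈ B(E)` of a measurable, `P`-essentially bounded function. -/
def integral (P : ProjValuedMeasure Ω E) (φ : Ω → ℂ) : E →L[ℂ] E :=
  if h : ∃ T, P.IsIntegral φ T then h.choose else 0

end ProjValuedMeasure

end ProjValuedMeasure

section HilbertTensor

variable {ι : Type*} [Fintype ι] (H : ι → Type*) [∀ j, NormedAddCommGroup (H j)]
  [∀ j, InnerProductSpace ℂ (H j)] [∀ j, CompleteSpace (H j)]

/-- The Hilbert space tensor product of the `H j`, realized as the space of square summable
functions on the product of the index sets of orthonormal bases of the `H j`. -/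
abbrev HilbertTensor : Type _ := lp (fun _ : (j : ι) → stdIdx (H j) => ℂ) 2

variable {H}

theorem memlp_pureTensor (x : (j : ι) → H j) :
    Memℓp (fun e : (j : ι) → stdIdx (H j) => ∏ j, (stdBasis (H j)).repr (x j) (e j)) 2 := by
  classical
  refine memℓp_gen ?_
  have hs : ∀ j, Summable fun e => ‖(stdBasis (H j)).repr (x j) e‖ ^ 2 := fun j => by
    have := (lp.memℓp ((stdBasis (H j)).repr (x j))).summable (by norm_num)
    simpa using this
  have h2 : ∀ e : (j : ι) → stdIdx (H j),
      ‖∏ j, (stdBasis (H j)).repr (x j) (e j)‖ ^ (2 : ℝ≥0∞).toReal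
        = ∏ j, ‖(stdBasis (H j)).repr (x j) (e j)‖ ^ 2 := fun e => by
    rw [norm_prod, Finset.prod_pow]
    simp
  simp_rw [h2]
  refine summable_of_sum_le (c := ∏ j, ∑' e, ‖(stdBasis (H j)).repr (x j) e‖ ^ 2)
    (fun _ => Finset.prod_nonneg fun _ _ => sq_nonneg _) fun s => ?_
  have hsub : s ⊆ Fintype.piFinset fun j => s.image fun e => e j := fun e he =>
    Fintype.mem_piFinset.2 fun j => Finset.mem_image_of_mem (fun e => e j) he
  refine (Finset.sum_le_sum_of_subset_of_nonneg hsub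
    fun _ _ _ => Finset.prod_nonneg fun _ _ => sq_nonneg _).trans ?_
  rw [← Finset.prod_univ_sum (fun j => s.image fun e => e j)
    (fun j e => ‖(stdBasis (H j)).repr (x j) e‖ ^ 2)]
  exact Finset.prod_le_prod (fun j _ => Finset.sum_nonneg fun _ _ => sq_nonneg _)
    fun j _ => (hs j).sum_le_tsum _ fun _ _ => sq_nonneg _

/-- The elementary tensor `⨂ⱼ xⱼ`: its coordinate at `(eⱼ)ⱼ` is `∏ⱼ ⟨xⱼ, eⱼ⟩`. -/
def pureTensor (x : (j : ι) → H j) : HilbertTensor H :=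
  ⟨fun e => ∏ j, (stdBasis (H j)).repr (x j) (e j), memlp_pureTensor x⟩

/-- `Q` is the tensor product `⨂ⱼ Pⱼ`, the unique projection-valued measure on the product
space with `Q(∏ⱼ Gⱼ) = ⨂ⱼ Pⱼ(Gⱼ)` for all measurable `Gⱼ`. -/
def IsTensorProduct {Ω : ι → Type*} [∀ j, MeasurableSpace (Ω j)]
    (P : (j : ι) → ProjValuedMeasure (Ω j) (H j))
    (Q : ProjValuedMeasure ((j : ι) → Ω j) (HilbertTensor H)) : Prop :=
  ∀ G : (j : ι) → Set (Ω j), (∀ j, MeasurableSet (G j)) → ∀ x : (j : ι) → H j,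
    Q.toFun (Set.univ.pi G) (pureTensor x) = pureTensor fun j => (P j).toFun (G j) (x j)

end HilbertTensor

section MOI

variable {k : ℕ} {Ω : Fin (k + 1) → Type*} [∀ j, MeasurableSpace (Ω j)]
  {H : Fin (k + 1) → Type*} [∀ j, NormedAddCommGroup (H j)]
  [∀ j, InnerProductSpace ℂ (H j)] [∀ j, CompleteSpace (H j)]
  {S : Type*} [MeasurableSpace S]

/-- `(S, ρ, φ₁, …, φₖ₊₁)` is an integral projective decomposition of `φ` with respect to the
tensor product of the `Pⱼ`. (The tensor product `Q` in `ae_eq` exists and is unique.) -/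
structure IsIPD (P : (j : Fin (k + 1)) → ProjValuedMeasure (Ω j) (H j))
    (φ : ((j : Fin (k + 1)) → Ω j) → ℂ) (ρ : Measure S)
    (φs : (j : Fin (k + 1)) → Ω j → S → ℂ) : Prop where
  sigmaFinite : SigmaFinite ρ
  measurable : ∀ j, Measurable fun p : Ω j × S => φs j p.1 p.2
  essNorm_lt_top : ∀ j s, (P j).essNorm (fun ω => φs j ω s) < ⊤
  upperIntegral_lt_top :
    upperIntegral ρ (fun s => ∏ j, (P j).essNorm fun ω => φs j ω s) < ⊤
  ae_eq : ∀ Q : ProjValuedMeasure ((j : Fin (k + 1)) → Ω j) (HilbertTensor H),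
    IsTensorProduct P Q → Q.AE fun ω =>
      Integrable (fun s => ∏ j, φs j (ω j) s) ρ ∧ φ ω = ∫ s, ∏ j, φs j (ω j) s ∂ρ

/-- The operator `P₁(φ₁(·,s)) b₁ ⋯ Pₖ(φₖ(·,s)) bₖ Pₖ₊₁(φₖ₊₁(·,s)) : Hₖ₊₁ → H₁`, composed by
recursion from left to right. -/
def moiIntegrand (P : (j : Fin (k + 1)) → ProjValuedMeasure (Ω j) (H j))
    (φs : (j : Fin (k + 1)) → Ω j → S → ℂ)
    (b : (j : Fin k) → H j.succ →L[ℂ] H j.castSucc) (s : S) : H (Fin.last k) →L[ℂ] H 0 :=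
  Fin.induction (motive := fun j => H j →L[ℂ] H 0)
    ((P 0).integral fun ω => φs 0 ω s)
    (fun j T => T ∘L b j ∘L (P j.succ).integral fun ω => φs j.succ ω s)
    (Fin.last k)

/-- The multiple operator integral `I^P(S, ρ, φ₁, …, φₖ₊₁)[b]`, a pointwise Pettis integral. -/
def multipleOperatorIntegral (P : (j : Fin (k + 1)) → ProjValuedMeasure (Ω j) (H j))
    (ρ : Measure S) (φs : (j : Fin (k + 1)) → Ω j → S → ℂ)
    (b : (j : Fin k) → H j.succ →L[ℂ] H j.castSucc) : H (Fin.last k) →L[ℂ] H 0 :=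
  pettisIntegral ρ (moiIntegrand P φs b)

end MOI

end OpInt

end

open Filter Topology InnerProductSpace

noncomputable section

namespace OpInt

/-! ### Trace class operators: the ideal property and finite rank approximation. -/

section TraceClass

section Contraction

variable {E : Type*} [NormedAddCommGroup E] [InnerProductSpace ℂ E]
variable {F : Type*} [NormedAddCommGroup F] [InnerProductSpace ℂ F]

/-! The integrand is Bochner integrable as a map into `TraceClass`, and the rest follows. That space
is complete, so the Bochner integral over every measurable set exists, and continuous functionals
pass through it, which makes it the Gel'fand–Pettis integral. The matrix coefficients `A ↦ ⟪y, A x⟫`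
are among these functionals, so the Bochner integral over the whole space has the coefficients that
characterize the pointwise Pettis integral, and uniqueness identifies the two.

Finiteness of the integral comes from the ideal estimates `traceNorm_comp_le_left` and
`traceNorm_comp_le_right` together with `‖P(φ)‖ ≤ ess sup |φ|` (`enorm_integral_le`): the trace norm
of the integrand is at most a constant times the product of the essential norms, which a finite
upper integral places almost everywhere below an integrable measurable function.

Strong measurability is the substantial point, since each `s ↦ P(φ(·, s))` is measurable only vector
by vector (`stronglyMeasurable_integral`). A trace class operator is an `S₁`-limit of finite sums of
`|A e⟩⟨e|` (`exists_tendsto_sum_rankOne`), and `B |u⟩⟨v| C = |B u⟩⟨C* v|` depends continuously on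
the vectors `B u` and `C* v`. Hence multiplication by pointwise measurable families, with measurable
adjoints on the right, preserves strong measurability in `S₁`.

The trace norm estimates rest on testing `∑ |⟪W e, A e⟫|` against contractions `W`
(`tsum_inner_contraction_le`, `traceNorm_le`). -/

theorem norm_le_one_of_contraction {W : E →L[ℂ] F} (hW : ∀ x, ‖W x‖ ≤ ‖x‖) : ‖W‖ ≤ 1 :=
  opNorm_le_bound _ zero_le_one fun x => by simpa using hW x

theorem contraction_of_norm_le_one {W : E →L[ℂ] F} (hW : ‖W‖ ≤ 1) (x : E) : ‖W x‖ ≤ ‖x‖ := by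
  simpa using W.le_of_opNorm_le hW x

/-- Reduces the ideal estimates to contractions, where the test sums over contractions apply
directly. -/
theorem exists_smul_contraction (C : E →L[ℂ] F) :
    ∃ D : E →L[ℂ] F, ‖D‖ ≤ 1 ∧ C = (‖C‖ : ℂ) • D := by
  rcases eq_or_ne C 0 with rfl | hC
  · exact ⟨0, by simp, by simp⟩
  · have h : ‖C‖ ≠ 0 := norm_ne_zero_iff.2 hC
    refine ⟨((‖C‖ : ℂ)⁻¹) • C, ?_, ?_⟩
    · rw [norm_smul]; simp [h]
    · rw [smul_smul, mul_inv_cancel₀ (by exact_mod_cast h), one_smul]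

end Contraction

variable {E : Type*} [NormedAddCommGroup E] [InnerProductSpace ℂ E] [CompleteSpace E]
variable {F : Type*} [NormedAddCommGroup F] [InnerProductSpace ℂ F] [CompleteSpace F]
variable {G : Type*} [NormedAddCommGroup G] [InnerProductSpace ℂ G] [CompleteSpace G]

theorem norm_adjoint_eq (A : E →L[ℂ] F) : ‖adjoint A‖ = ‖A‖ :=
  LinearIsometryEquiv.norm_map _ _

/-- The Hilbert-Schmidt norm decreases under composition with a contraction on the right. -/
theorem tsum_norm_sq_comp_contraction_le (S : E →L[ℂ] F) {C : G →L[ℂ] E} (hC : ‖C‖ ≤ 1) :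
    ∑' e, ENNReal.ofReal (‖S (C (stdBasis G e))‖ ^ 2) ≤
      ∑' e, ENNReal.ofReal (‖S (stdBasis E e)‖ ^ 2) := by
  have h := tsum_norm_sq_eq (S ∘L C)
  simp only [comp_apply] at h
  rw [h, tsum_norm_sq_eq S]
  refine ENNReal.tsum_le_tsum fun e => ENNReal.ofReal_le_ofReal ?_
  rw [adjoint_comp, comp_apply]
  have := contraction_of_norm_le_one ((norm_adjoint_eq C).trans_le hC) (adjoint S (stdBasis F e))
  gcongr

/-- Write `A ≈ V |A|` with a contraction `V` and split `|A| = S²`: the summand becomes `⟪S V* W e, S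
C e⟫`, up to a small error. The weight `δ` is free: `δ = 1` gives the ideal property, while a small
`δ` exploits smallness of `S C`. Only the basis vectors need to satisfy `‖C e‖ ≤ 1`. -/
theorem tsum_inner_comp_le (A : E →L[ℂ] F) (W : G →L[ℂ] F) (C : G →L[ℂ] E)
    (hW : ∀ x, ‖W x‖ ≤ ‖x‖) (hC : ∀ e, ‖C (stdBasis G e)‖ ≤ 1) {δ : ℝ} (hδ : 0 < δ) :
    ∑' e, ENNReal.ofReal ‖⟪W (stdBasis G e), A (C (stdBasis G e))⟫_ℂ‖ ≤
      ENNReal.ofReal (δ / 2) * traceNorm A + ENNReal.ofReal (δ⁻¹ / 2) *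
        ∑' e, ENNReal.ofReal (‖CFC.sqrt (absOp A) (C (stdBasis G e))‖ ^ 2) := by
  set S := CFC.sqrt (absOp A) with hSdef
  have hS : 0 ≤ S := CFC.sqrt_nonneg _
  have hSS : ∀ x, absOp A x = S (S x) := fun x => by
    rw [← mul_apply_eq_comp, CFC.sqrt_mul_sqrt_self _ (absOp_nonneg A)]
  rw [ENNReal.tsum_eq_iSup_sum]
  refine iSup_le fun s => le_of_forall_le_add_card s.card fun ε hε => ?_
  obtain ⟨V, hV, hA, -⟩ := exists_contraction A hε
  set D : G →L[ℂ] E := adjoint V ∘L W with hDdef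
  have hD : ‖D‖ ≤ 1 := by
    refine (opNorm_comp_le _ _).trans ?_
    rw [norm_adjoint_eq]
    exact mul_le_one₀ (norm_le_one_of_contraction hV) (norm_nonneg _)
      (norm_le_one_of_contraction hW)
  have key : ∀ e, ‖⟪W (stdBasis G e), A (C (stdBasis G e))⟫_ℂ‖ ≤
      (δ / 2) * ‖S (D (stdBasis G e))‖ ^ 2 + (δ⁻¹ / 2) * ‖S (C (stdBasis G e))‖ ^ 2 + ε := by
    intro e
    set x := stdBasis G e
    have hx : ‖x‖ = 1 := norm_stdBasis e
    have h1 : ⟪W x, A (C x)⟫_ℂ = ⟪S (D x), S (C x)⟫_ℂ + (ε : ℂ) * ⟪W x, V (C x)⟫_ℂ := by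
      rw [hA, inner_add_right, inner_smul_right, inner_map_eq_of_nonneg hS, ← hSS, hDdef,
        comp_apply, adjoint_inner_left]
    have h2 : ‖(ε : ℂ) * ⟪W x, V (C x)⟫_ℂ‖ ≤ ε := by
      rw [norm_mul, Complex.norm_real, Real.norm_of_nonneg hε.le]
      refine mul_le_of_le_one_right hε.le ((norm_inner_le_norm _ _).trans ?_)
      exact mul_le_one₀ ((hW x).trans_eq hx) (norm_nonneg _) ((hV _).trans (hC e))
    have h3 : ‖⟪S (D x), S (C x)⟫_ℂ‖ ≤ (δ / 2) * ‖S (D x)‖ ^ 2 + (δ⁻¹ / 2) * ‖S (C x)‖ ^ 2 := by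
      refine (norm_inner_le_norm _ _).trans ?_
      -- Weighted arithmetic-geometric mean inequality, by completing the square.
      have h4 : (δ / 2) * ‖S (D x)‖ ^ 2 + (δ⁻¹ / 2) * ‖S (C x)‖ ^ 2 - ‖S (D x)‖ * ‖S (C x)‖
          = (δ⁻¹ / 2) * (δ * ‖S (D x)‖ - ‖S (C x)‖) ^ 2 := by
        field_simp
        ring
      have h5 : 0 ≤ (δ⁻¹ / 2) * (δ * ‖S (D x)‖ - ‖S (C x)‖) ^ 2 := by positivity
      linarith
    rw [h1]
    exact (norm_add_le _ _).trans (add_le_add h3 h2)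
  calc ∑ e ∈ s, ENNReal.ofReal ‖⟪W (stdBasis G e), A (C (stdBasis G e))⟫_ℂ‖
      ≤ ∑ e ∈ s, (ENNReal.ofReal (δ / 2) * ENNReal.ofReal (‖S (D (stdBasis G e))‖ ^ 2)
          + ENNReal.ofReal (δ⁻¹ / 2) * ENNReal.ofReal (‖S (C (stdBasis G e))‖ ^ 2)
          + ENNReal.ofReal ε) := by
        refine Finset.sum_le_sum fun e _ => ?_
        rw [← ENNReal.ofReal_mul (by positivity), ← ENNReal.ofReal_mul (by positivity),
          ← ENNReal.ofReal_add (by positivity) (by positivity),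
          ← ENNReal.ofReal_add (by positivity) hε.le]
        exact ENNReal.ofReal_le_ofReal (key e)
    _ = ENNReal.ofReal (δ / 2) * ∑ e ∈ s, ENNReal.ofReal (‖S (D (stdBasis G e))‖ ^ 2)
          + ENNReal.ofReal (δ⁻¹ / 2) * ∑ e ∈ s, ENNReal.ofReal (‖S (C (stdBasis G e))‖ ^ 2)
          + s.card * ENNReal.ofReal ε := by
        rw [Finset.sum_add_distrib, Finset.sum_add_distrib, Finset.mul_sum, Finset.mul_sum,
          Finset.sum_const, nsmul_eq_mul]
    _ ≤ _ := by
        have h1 := (ENNReal.sum_le_tsum s).trans (tsum_norm_sq_comp_contraction_le S hD)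
        have h2 := ENNReal.sum_le_tsum
          (f := fun e => ENNReal.ofReal (‖S (C (stdBasis G e))‖ ^ 2)) s
        rw [hSdef, ← traceNorm_eq_tsum_sqrt] at h1
        gcongr

theorem traceNorm_comp_contraction_le (A : E →L[ℂ] F) {C : G →L[ℂ] E} (hC : ‖C‖ ≤ 1) :
    traceNorm (A ∘L C) ≤ traceNorm A := by
  refine traceNorm_le _ _ fun W hW => ?_
  refine (tsum_inner_comp_le A W C hW (fun e => (contraction_of_norm_le_one hC _).trans_eq
    (norm_stdBasis e)) one_pos).trans ?_
  have h := tsum_norm_sq_comp_contraction_le (CFC.sqrt (absOp A)) hC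
  rw [← traceNorm_eq_tsum_sqrt] at h
  calc _ ≤ ENNReal.ofReal (1 / 2) * traceNorm A + ENNReal.ofReal (1⁻¹ / 2) * traceNorm A := by
        gcongr
    _ = traceNorm A := by
        rw [← add_mul, ← ENNReal.ofReal_add (by norm_num) (by norm_num)]
        norm_num

/-- The factor `B` moves to the other side of the inner product, and `B* W` is again a contraction
to test with. -/
theorem contraction_comp_traceNorm_le (A : E →L[ℂ] F) {B : F →L[ℂ] G} (hB : ‖B‖ ≤ 1) :
    traceNorm (B ∘L A) ≤ traceNorm A := by
  refine traceNorm_le _ _ fun W hW => ?_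
  refine le_trans (le_of_eq ?_) (tsum_inner_contraction_le A (adjoint B ∘L W) fun x => ?_)
  · simp only [comp_apply, adjoint_inner_left]
  · exact (contraction_of_norm_le_one ((norm_adjoint_eq B).trans_le hB) _).trans (hW x)

theorem traceNorm_norm_smul_le {X : Type*} [NormedAddCommGroup X] (x : X) (A : E →L[ℂ] F) :
    traceNorm ((‖x‖ : ℂ) • A) ≤ ‖x‖ₑ * traceNorm A := by
  refine (traceNorm_smul_le _ _).trans_eq ?_
  rw [Complex.norm_real, norm_norm, ofReal_norm]

theorem traceNorm_comp_le_right (A : E →L[ℂ] F) (C : G →L[ℂ] E) :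
    traceNorm (A ∘L C) ≤ ‖C‖ₑ * traceNorm A := by
  obtain ⟨D, hD, h⟩ := exists_smul_contraction C
  calc traceNorm (A ∘L C) = traceNorm ((‖C‖ : ℂ) • (A ∘L D)) := by
        conv_lhs => rw [h]
        rw [comp_smul]
    _ ≤ ‖C‖ₑ * traceNorm (A ∘L D) := traceNorm_norm_smul_le _ _
    _ ≤ _ := by gcongr; exact traceNorm_comp_contraction_le A hD

theorem traceNorm_comp_le_left (B : F →L[ℂ] G) (A : E →L[ℂ] F) :
    traceNorm (B ∘L A) ≤ ‖B‖ₑ * traceNorm A := by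
  obtain ⟨D, hD, h⟩ := exists_smul_contraction B
  calc traceNorm (B ∘L A) = traceNorm ((‖B‖ : ℂ) • (D ∘L A)) := by
        conv_lhs => rw [h]
        rw [smul_comp]
    _ ≤ ‖B‖ₑ * traceNorm (D ∘L A) := traceNorm_norm_smul_le _ _
    _ ≤ _ := by gcongr; exact contraction_comp_traceNorm_le A hD

/-- Parseval and self-adjointness give `‖S x‖² = ∑ |⟪S e, x⟫|²`; Cauchy–Schwarz then applies
termwise. This bounds the operator norm by the Hilbert–Schmidt norm. -/
theorem norm_sq_le_tsum_mul (S : E →L[ℂ] E) (hS : 0 ≤ S) (x : E) :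
    ENNReal.ofReal (‖S x‖ ^ 2) ≤
      (∑' e, ENNReal.ofReal (‖S (stdBasis E e)‖ ^ 2)) * ENNReal.ofReal (‖x‖ ^ 2) := by
  rw [parseval_stdBasis, ← ENNReal.tsum_mul_right]
  refine ENNReal.tsum_le_tsum fun e => ?_
  rw [← ENNReal.ofReal_mul (sq_nonneg _), ← mul_pow, ← inner_map_eq_of_nonneg hS]
  refine ENNReal.ofReal_le_ofReal ?_
  gcongr
  exact norm_inner_le_norm _ _

/-- With `S = |A|^{1/2}`, `‖A x‖ = ‖S (S x)‖`, and the squared Hilbert–Schmidt norm of `S` is the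
trace norm of `A`. -/
theorem norm_le_toReal_traceNorm {A : E →L[ℂ] F} (hA : traceNorm A < ⊤) :
    ‖A‖ ≤ (traceNorm A).toReal := by
  set S := CFC.sqrt (absOp A) with hSdef
  set t := (traceNorm A).toReal with ht
  have ht0 : 0 ≤ t := ENNReal.toReal_nonneg
  have hS : ∀ x, ‖S x‖ ^ 2 ≤ t * ‖x‖ ^ 2 := fun x => by
    have h := norm_sq_le_tsum_mul S (CFC.sqrt_nonneg _) x
    rw [hSdef, ← traceNorm_eq_tsum_sqrt, ← ENNReal.ofReal_toReal hA.ne,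
      ← ENNReal.ofReal_mul ENNReal.toReal_nonneg,
      ENNReal.ofReal_le_ofReal_iff (by positivity)] at h
    exact h
  refine opNorm_le_bound _ ht0 fun x => ?_
  refine le_of_sq_le_sq ?_ (by positivity)
  have h1 : ‖A x‖ ^ 2 = ‖S (S x)‖ ^ 2 := by
    rw [← norm_absOp_apply, hSdef, sqrt_sqrt_apply (absOp_nonneg A)]
  rw [h1, mul_pow]
  nlinarith [hS x, hS (S x), mul_le_mul_of_nonneg_left (hS x) ht0]

/-- Lower semicontinuity: each finite part of a test sum is continuous in the operator norm. -/
theorem traceNorm_le_of_tendsto {T : ℕ → E →L[ℂ] F} {A : E →L[ℂ] F} {c : ℝ≥0∞}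
    (hT : Tendsto T atTop (𝓝 A)) (hc : ∀ᶠ n in atTop, traceNorm (T n) ≤ c) :
    traceNorm A ≤ c := by
  refine traceNorm_le _ _ fun W hW => ?_
  rw [ENNReal.tsum_eq_iSup_sum]
  refine iSup_le fun s => ?_
  have h : Tendsto
      (fun n => ∑ e ∈ s, ENNReal.ofReal ‖⟪W (stdBasis E e), T n (stdBasis E e)⟫_ℂ‖) atTop
      (𝓝 (∑ e ∈ s, ENNReal.ofReal ‖⟪W (stdBasis E e), A (stdBasis E e)⟫_ℂ‖)) := by
    refine tendsto_finsetSum _ fun e _ => ENNReal.tendsto_ofReal ?_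
    exact (tendsto_const_nhds.inner
      ((ContinuousLinearMap.apply ℂ F (stdBasis E e)).continuous.tendsto A |>.comp hT)).norm
  refine le_of_tendsto h (hc.mono fun n hn => ?_)
  exact (ENNReal.sum_le_tsum s).trans ((tsum_inner_contraction_le _ W hW).trans hn)

theorem finite_stdIdx_complex : Finite (stdIdx ℂ) :=
  LinearIndependent.finite (R := ℂ) (stdBasis ℂ).orthonormal.linearIndependent

theorem traceNorm_one_complex_lt_top : traceNorm (1 : ℂ →L[ℂ] ℂ) < ⊤ := by
  have := finite_stdIdx_complex
  have := Fintype.ofFinite (stdIdx ℂ)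
  rw [traceNorm, tsum_fintype]
  exact ENNReal.sum_lt_top.2 fun _ _ => ENNReal.ofReal_lt_top

/-- A rank one operator factors through `ℂ`, so the ideal property applies. Of the constant
`traceNorm 1` only finiteness matters. -/
theorem traceNorm_rankOne_le (u : F) (v : E) :
    traceNorm (rankOne ℂ u v) ≤ ‖u‖ₑ * (‖v‖ₑ * traceNorm (1 : ℂ →L[ℂ] ℂ)) := by
  have h : (rankOne ℂ u v : E →L[ℂ] F) = (toSpanSingleton ℂ u) ∘L
      ((1 : ℂ →L[ℂ] ℂ) ∘L (innerSL ℂ v)) := by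
    ext x; simp
  rw [h]
  refine (traceNorm_comp_le_left _ _).trans (mul_le_mul' ?_
    ((traceNorm_comp_le_right _ _).trans (mul_le_mul' ?_ le_rfl)))
  · rw [← ofReal_norm, ← ofReal_norm]
    exact ENNReal.ofReal_le_ofReal (by simp)
  · rw [← ofReal_norm, ← ofReal_norm]
    exact ENNReal.ofReal_le_ofReal (by simp)

theorem traceNorm_rankOne_lt_top (u : F) (v : E) : traceNorm (rankOne ℂ u v) < ⊤ :=
  (traceNorm_rankOne_le u v).trans_lt (ENNReal.mul_lt_top enorm_lt_top
    (ENNReal.mul_lt_top enorm_lt_top traceNorm_one_complex_lt_top))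

/-- The partial sums `∑ₑ |e⟩⟨e|` of the resolution of the identity. -/
def basisProj (s : Finset (stdIdx E)) : E →L[ℂ] E :=
  ∑ e ∈ s, rankOne ℂ (stdBasis E e) (stdBasis E e)

open Classical in
theorem basisProj_apply (s : Finset (stdIdx E)) (e : stdIdx E) :
    basisProj s (stdBasis E e) = if e ∈ s then stdBasis E e else 0 := by
  rw [basisProj, sum_apply]
  simp only [rankOne_apply, (orthonormal_iff_ite.1 (stdBasis E).orthonormal), ite_smul, one_smul,
    zero_smul]
  rw [Finset.sum_ite_eq']

/-- The operator `|A|^{1/2}` is Hilbert–Schmidt, so its square sum off a large finite set is small.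
In `tsum_inner_comp_le` a small `δ` controls the first term, and the finite set, chosen after `δ`,
controls the second. -/
theorem exists_finset_traceNorm_sub_le {A : E →L[ℂ] F} (hA : traceNorm A < ⊤) {ε : ℝ}
    (hε : 0 < ε) : ∃ s, traceNorm (A - A ∘L basisProj s) ≤ ENNReal.ofReal ε := by
  classical
  set S := CFC.sqrt (absOp A) with hSdef
  set t := (traceNorm A).toReal with ht
  have ht0 : 0 ≤ t := ENNReal.toReal_nonneg
  -- This gives `δ * t ≤ ε`, the `+ 1` avoiding division by zero; a tail of at most `δ * ε` then
  -- contributes at most `ε / 2`.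
  set δ : ℝ := ε / (t + 1) with hδ
  have hδ0 : 0 < δ := by positivity
  have htail := ENNReal.tendsto_tsum_compl_atTop_zero
    (f := fun e => ENNReal.ofReal (‖S (stdBasis E e)‖ ^ 2))
    (by rw [hSdef, ← traceNorm_eq_tsum_sqrt]; exact hA.ne)
  obtain ⟨s, hs⟩ := (htail.eventually_le_const
    (ENNReal.ofReal_pos.2 (mul_pos hδ0 hε) : 0 < ENNReal.ofReal (δ * ε))).exists
  refine ⟨s, ?_⟩
  have hC : ∀ e, ((1 : E →L[ℂ] E) - basisProj s) (stdBasis E e)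
      = if e ∈ s then 0 else stdBasis E e := fun e => by
    rw [sub_apply, basisProj_apply, one_apply_eq_self]
    split_ifs <;> simp
  have hAC : A - A ∘L basisProj s = A ∘L (1 - basisProj s) := by
    ext x; simp
  rw [hAC]
  refine traceNorm_le _ _ fun W hW => ?_
  refine (tsum_inner_comp_le A W _ hW (fun e => ?_) hδ0).trans ?_
  · rw [hC]
    split_ifs
    · simp
    · exact (norm_stdBasis e).le
  · have h1 : ∑' e, ENNReal.ofReal
        (‖CFC.sqrt (absOp A) (((1 : E →L[ℂ] E) - basisProj s) (stdBasis E e))‖ ^ 2)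
        = ∑' e : {x // x ∉ s}, ENNReal.ofReal (‖S (stdBasis E (e : stdIdx E))‖ ^ 2) := by
      rw [show (∑' e : {x // x ∉ s}, ENNReal.ofReal (‖S (stdBasis E (e : stdIdx E))‖ ^ 2))
        = _ from tsum_subtype {x | x ∉ s} (fun e => ENNReal.ofReal (‖S (stdBasis E e)‖ ^ 2))]
      refine tsum_congr fun e => ?_
      rw [hC, Set.indicator_apply]
      by_cases he : e ∈ s <;> simp [he, hSdef]
    rw [h1, ← ENNReal.ofReal_toReal hA.ne]
    calc _ ≤ ENNReal.ofReal (δ / 2) * ENNReal.ofReal t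
          + ENNReal.ofReal (δ⁻¹ / 2) * ENNReal.ofReal (δ * ε) := by gcongr
      _ = ENNReal.ofReal (δ / 2 * t + δ⁻¹ / 2 * (δ * ε)) := by
          rw [← ENNReal.ofReal_mul (by positivity), ← ENNReal.ofReal_mul (by positivity),
            ← ENNReal.ofReal_add (by positivity) (by positivity)]
      _ ≤ ENNReal.ofReal ε := by
          refine ENNReal.ofReal_le_ofReal ?_
          have h2 : δ * t ≤ ε := by
            rw [hδ, div_mul_eq_mul_div, div_le_iff₀ (by positivity)]
            nlinarith
          have h3 : δ⁻¹ / 2 * (δ * ε) = ε / 2 := by field_simp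
          rw [h3]
          linarith

/-! ### The Banach space `S₁` and its multiplication maps. -/

namespace TraceClass

theorem norm_def (A : TraceClass E F) : ‖A‖ = (traceNorm A.toCLM).toReal := rfl

theorem enorm_def (A : TraceClass E F) : ‖A‖ₑ = traceNorm A.toCLM := by
  rw [← ofReal_norm, norm_def]
  exact ENNReal.ofReal_toReal A.2.ne

theorem toCLM_mk (A : E →L[ℂ] F) (hA : traceNorm A < ⊤) : (mk A hA).toCLM = A := rfl

theorem toCLM_sub (A B : TraceClass E F) : (A - B).toCLM = A.toCLM - B.toCLM := rfl

theorem toCLM_injective : Function.Injective (toCLM : TraceClass E F → E →L[ℂ] F) :=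
  Subtype.val_injective

variable (E F) in
/-- The inclusion of `S₁(E; F)` into the bounded operators, linear and of norm at most `1`. -/
def inclusion : TraceClass E F →L[ℂ] (E →L[ℂ] F) :=
  LinearMap.mkContinuous
    { toFun := toCLM
      map_add' := fun _ _ => rfl
      map_smul' := fun _ _ => rfl } 1
    fun A => by rw [one_mul]; exact norm_le_toReal_traceNorm A.2

theorem inclusion_apply (A : TraceClass E F) : inclusion E F A = A.toCLM := rfl

/-- A Cauchy sequence in `S₁` converges in operator norm, and lower semicontinuity upgrades this to
convergence in `S₁`. -/
instance : CompleteSpace (TraceClass E F) := by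
  refine Metric.complete_of_cauchySeq_tendsto fun u hu => ?_
  have hcau : CauchySeq fun n => (u n).toCLM :=
    hu.map (inclusion E F).uniformContinuous
  obtain ⟨A, hA⟩ := cauchySeq_tendsto_of_complete hcau
  have key : ∀ ε : ℝ, 0 < ε → ∃ N, ∀ n ≥ N, traceNorm (A - (u n).toCLM) ≤ ENNReal.ofReal ε := by
    intro ε hε
    obtain ⟨N, hN⟩ := Metric.cauchySeq_iff.1 hu ε hε
    refine ⟨N, fun n hn => traceNorm_le_of_tendsto (hA.sub_const _) ?_⟩
    filter_upwards [eventually_ge_atTop N] with m hm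
    have h := (hN m hm n hn).le
    rw [dist_eq_norm, norm_def, toCLM_sub] at h
    exact (ENNReal.ofReal_toReal (u m - u n).2.ne).symm.trans_le (ENNReal.ofReal_le_ofReal h)
  have hAt : traceNorm A < ⊤ := by
    obtain ⟨N, hN⟩ := key 1 one_pos
    have h := traceNorm_add_le (A - (u N).toCLM) (u N).toCLM
    rw [sub_add_cancel] at h
    exact h.trans_lt (ENNReal.add_lt_top.2
      ⟨(hN N le_rfl).trans_lt ENNReal.ofReal_lt_top, (u N).2⟩)
  refine ⟨mk A hAt, Metric.tendsto_atTop.2 fun ε hε => ?_⟩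
  obtain ⟨N, hN⟩ := key (ε / 2) (half_pos hε)
  refine ⟨N, fun n hn => ?_⟩
  rw [dist_comm, dist_eq_norm, norm_def, toCLM_sub, toCLM_mk]
  refine lt_of_le_of_lt (ENNReal.toReal_le_of_le_ofReal (half_pos hε).le (hN n hn)) (half_lt_self hε)

/-- The rank one operator `|u⟩⟨v|` as a trace class operator. -/
def rankOne (u : F) (v : E) : TraceClass E F :=
  mk (InnerProductSpace.rankOne ℂ u v) (traceNorm_rankOne_lt_top u v)

theorem toCLM_rankOne (u : F) (v : E) :
    (rankOne u v).toCLM = InnerProductSpace.rankOne ℂ u v := rfl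

theorem continuous_rankOne : Continuous fun p : F × E => rankOne p.1 p.2 := by
  set c := (traceNorm (1 : ℂ →L[ℂ] ℂ)).toReal
  have hb : ∀ (u : F) (v : E), ‖rankOne u v‖ ≤ ‖u‖ * (‖v‖ * c) := fun u v => by
    have h := ENNReal.toReal_mono (ENNReal.mul_ne_top enorm_ne_top
      (ENNReal.mul_ne_top enorm_ne_top traceNorm_one_complex_lt_top.ne)) (traceNorm_rankOne_le u v)
    rwa [ENNReal.toReal_mul, ENNReal.toReal_mul, toReal_enorm, toReal_enorm] at h
  refine continuous_iff_continuousAt.2 fun p => ?_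
  rw [ContinuousAt, tendsto_iff_norm_sub_tendsto_zero]
  refine squeeze_zero (fun _ => norm_nonneg _)
    (g := fun q : F × E => ‖q.1 - p.1‖ * (‖q.2‖ * c) + ‖p.1‖ * (‖q.2 - p.2‖ * c)) (fun q => ?_) ?_
  · have h : rankOne q.1 q.2 - rankOne p.1 p.2
        = rankOne (q.1 - p.1) q.2 + rankOne p.1 (q.2 - p.2) := by
      refine toCLM_injective ?_
      change InnerProductSpace.rankOne ℂ q.1 q.2 - InnerProductSpace.rankOne ℂ p.1 p.2
        = InnerProductSpace.rankOne ℂ (q.1 - p.1) q.2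
          + InnerProductSpace.rankOne ℂ p.1 (q.2 - p.2)
      simp
    rw [h]
    exact (norm_add_le _ _).trans (add_le_add (hb _ _) (hb _ _))
  · have h : Continuous
        fun q : F × E => ‖q.1 - p.1‖ * (‖q.2‖ * c) + ‖p.1‖ * (‖q.2 - p.2‖ * c) := by fun_prop
    simpa using h.tendsto p

/-- Trace class operators are limits in `S₁` of finite sums of rank one operators. -/
theorem exists_tendsto_sum_rankOne (A : TraceClass E F) :
    ∃ s : ℕ → Finset (stdIdx E), Tendsto
      (fun n => ∑ e ∈ s n, rankOne (A.toCLM (stdBasis E e)) (stdBasis E e)) atTop (𝓝 A) := by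
  -- A sequence of finite sets, in place of the net of all of them, keeps the later measurability
  -- limits countable.
  choose s hs using fun n : ℕ =>
    exists_finset_traceNorm_sub_le A.2 (ε := 1 / ((n : ℝ) + 1)) (by positivity)
  refine ⟨s, tendsto_iff_norm_sub_tendsto_zero.2 ?_⟩
  refine squeeze_zero (fun _ => norm_nonneg _) (fun n => ?_) tendsto_one_div_add_atTop_nhds_zero_nat
  rw [norm_sub_rev, norm_def, toCLM_sub]
  have h : (∑ e ∈ s n, rankOne (A.toCLM (stdBasis E e)) (stdBasis E e)).toCLM
      = A.toCLM ∘L basisProj (s n) := by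
    rw [← inclusion_apply, map_sum, basisProj]
    ext x
    simp [inclusion_apply, toCLM_rankOne]
  rw [h]
  exact ENNReal.toReal_le_of_le_ofReal (by positivity) (hs n)

/-- Composition with a bounded operator on the left, as a map of trace class operators. -/
def compLeft (B : F →L[ℂ] G) : TraceClass E F →L[ℂ] TraceClass E G :=
  LinearMap.mkContinuous
    { toFun := fun A => mk (B ∘L A.toCLM)
        ((traceNorm_comp_le_left B _).trans_lt (ENNReal.mul_lt_top enorm_lt_top A.2))
      map_add' := fun A A' => toCLM_injective (comp_add B A.toCLM A'.toCLM)
      map_smul' := fun c A => toCLM_injective (comp_smul B c A.toCLM) } ‖B‖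
    fun A => by
      have h := ENNReal.toReal_mono (ENNReal.mul_ne_top enorm_ne_top A.2.ne)
        (traceNorm_comp_le_left B A.toCLM)
      rwa [ENNReal.toReal_mul, toReal_enorm] at h

theorem toCLM_compLeft (B : F →L[ℂ] G) (A : TraceClass E F) :
    (compLeft B A).toCLM = B ∘L A.toCLM := rfl

/-- Composition with a bounded operator on the right, as a map of trace class operators. -/
def compRight (C : G →L[ℂ] E) : TraceClass E F →L[ℂ] TraceClass G F :=
  LinearMap.mkContinuous
    { toFun := fun A => mk (A.toCLM ∘L C)
        ((traceNorm_comp_le_right _ C).trans_lt (ENNReal.mul_lt_top enorm_lt_top A.2))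
      map_add' := fun A A' => toCLM_injective (add_comp A.toCLM A'.toCLM C)
      map_smul' := fun c A => toCLM_injective (smul_comp c A.toCLM C) } ‖C‖
    fun A => by
      have h := ENNReal.toReal_mono (ENNReal.mul_ne_top enorm_ne_top A.2.ne)
        (traceNorm_comp_le_right A.toCLM C)
      rwa [ENNReal.toReal_mul, toReal_enorm] at h

theorem toCLM_compRight (C : G →L[ℂ] E) (A : TraceClass E F) :
    (compRight C A).toCLM = A.toCLM ∘L C := rfl

theorem compLeft_rankOne (B : F →L[ℂ] G) (u : F) (v : E) :
    compLeft B (rankOne u v) = rankOne (B u) v := by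
  refine toCLM_injective ?_
  ext x
  simp [toCLM_compLeft, toCLM_rankOne]

theorem compRight_rankOne (C : G →L[ℂ] E) (u : F) (v : E) :
    compRight C (rankOne u v) = rankOne u (adjoint C v) := by
  refine toCLM_injective ?_
  ext x
  simp [toCLM_compRight, toCLM_rankOne, adjoint_inner_left]

end TraceClass

end TraceClass

/-! ### Projection-valued measures and their bounded functional calculus. -/

theorem norm_sum_sq_of_pairwise_inner_eq_zero {ι E : Type*} [NormedAddCommGroup E]
    [InnerProductSpace ℂ E] (s : Finset ι) (v : ι → E)
    (hv : ∀ i ∈ s, ∀ j ∈ s, i ≠ j → ⟪v i, v j⟫_ℂ = 0) :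
    ‖∑ i ∈ s, v i‖ ^ 2 = ∑ i ∈ s, ‖v i‖ ^ 2 := by
  have h : ⟪∑ i ∈ s, v i, ∑ i ∈ s, v i⟫_ℂ = ∑ i ∈ s, ⟪v i, v i⟫_ℂ := by
    rw [sum_inner]
    refine Finset.sum_congr rfl fun i hi => ?_
    rw [inner_sum]
    exact Finset.sum_eq_single_of_mem i hi fun j hj hji => hv i hi j hj hji.symm
  simp only [inner_self_eq_norm_sq_to_K] at h
  exact_mod_cast h

namespace ProjValuedMeasure

variable {Ω : Type*} [MeasurableSpace Ω]
variable {E : Type*} [NormedAddCommGroup E] [InnerProductSpace ℂ E] [CompleteSpace E]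
variable (P : ProjValuedMeasure Ω E)

theorem map_union {A B : Set Ω} (hA : MeasurableSet A) (hB : MeasurableSet B)
    (hd : Disjoint A B) : P.toFun (A ∪ B) = P.toFun A + P.toFun B := by
  let G : ℕ → Set Ω := fun n => if n = 0 then A else if n = 1 then B else ∅
  have hG : ∀ n, MeasurableSet (G n) := fun n => by
    simp only [G]
    split_ifs <;> simp [hA, hB]
  have hGd : Pairwise fun m n => Disjoint (G m) (G n) := fun m n hmn => by
    simp only [G]
    split_ifs <;> first | omega | exact hd | exact hd.symm | simp
  have hU : ⋃ n, G n = A ∪ B := by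
    ext ω
    simp only [Set.mem_iUnion, Set.mem_union, G]
    refine ⟨fun ⟨n, hn⟩ => ?_, fun h => h.elim (fun h => ⟨0, by simpa using h⟩)
      fun h => ⟨1, by simpa using h⟩⟩
    split_ifs at hn
    · exact Or.inl hn
    · exact Or.inr hn
    · exact absurd hn (Set.notMem_empty _)
  ext x
  refine ext_inner_left ℂ fun y => ?_
  have h1 := P.hasSum_iUnion G hG hGd x y
  rw [hU] at h1
  have h2 : HasSum (fun n => ⟪y, P.toFun (G n) x⟫_ℂ)
      (∑ n ∈ Finset.range 2, ⟪y, P.toFun (G n) x⟫_ℂ) := by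
    refine hasSum_sum_of_ne_finset_zero fun n hn => ?_
    have h0 : n ≠ 0 := fun h => hn (by simp [h])
    have h1 : n ≠ 1 := fun h => hn (by simp [h])
    simp [G, h0, h1, P.map_empty]
  rw [h1.unique h2, Finset.sum_range_succ, Finset.sum_range_one, add_apply, inner_add_right]
  simp [G]

theorem map_compl {A : Set Ω} (hA : MeasurableSet A) : P.toFun Aᶜ = 1 - P.toFun A := by
  rw [eq_sub_iff_add_eq', ← P.map_union hA hA.compl disjoint_compl_right, Set.union_compl_self,
    P.map_univ]

/-- For `p = P(A)` and `q = P(B)`, idempotence of `p`, `q` and `p + q` forces `pq + qp = 0`.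
Multiplying by `p` on either side gives `pq = -pqp = qp`, so `2pq = 0`. -/
theorem mul_eq_zero_of_disjoint {A B : Set Ω} (hA : MeasurableSet A) (hB : MeasurableSet B)
    (hd : Disjoint A B) : P.toFun A * P.toFun B = 0 := by
  have hp := (P.isStarProjection A hA).isIdempotentElem.eq
  have hq := (P.isStarProjection B hB).isIdempotentElem.eq
  have hs := (P.isStarProjection _ (hA.union hB)).isIdempotentElem.eq
  rw [P.map_union hA hB hd] at hs
  set p := P.toFun A
  set q := P.toFun B
  have h1 : p * q + q * p = 0 := by
    rw [add_mul, mul_add, mul_add, hp, hq] at hs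
    have : p + q + (p * q + q * p) = p + q + 0 := by rw [add_zero]; refine Eq.trans ?_ hs; abel
    exact add_left_cancel this
  have h2 : p * q + p * q * p = 0 := by
    have := congrArg (p * ·) h1
    simpa [mul_add, ← mul_assoc, hp] using this
  have h3 : p * q * p + q * p = 0 := by
    have := congrArg (· * p) h1
    simpa [add_mul, mul_assoc, hp] using this
  have h4 : p * q = q * p := by
    rw [eq_neg_of_add_eq_zero_left h2, eq_neg_of_add_eq_zero_right h3]
  rw [← h4, ← two_smul ℂ] at h1
  exact (smul_eq_zero.1 h1).resolve_left two_ne_zero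

theorem inner_apply_apply {A : Set Ω} (hA : MeasurableSet A) (x y : E) :
    ⟪P.toFun A x, P.toFun A y⟫_ℂ = ⟪x, P.toFun A y⟫_ℂ := by
  rw [inner_map_eq_of_nonneg (P.isStarProjection A hA).nonneg, ← mul_apply_eq_comp,
    (P.isStarProjection A hA).isIdempotentElem.eq]

theorem inner_apply_eq_zero_of_disjoint {A B : Set Ω} (hA : MeasurableSet A)
    (hB : MeasurableSet B) (hd : Disjoint A B) (x y : E) :
    ⟪P.toFun A x, P.toFun B y⟫_ℂ = 0 := by
  rw [inner_map_eq_of_nonneg (P.isStarProjection A hA).nonneg, ← mul_apply_eq_comp,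
    P.mul_eq_zero_of_disjoint hA hB hd, zero_apply, inner_zero_right]

theorem inner_self_apply {A : Set Ω} (hA : MeasurableSet A) (x : E) :
    ⟪x, P.toFun A x⟫_ℂ = ((‖P.toFun A x‖ ^ 2 : ℝ) : ℂ) := by
  rw [← P.inner_apply_apply hA, inner_self_eq_norm_sq_to_K]
  norm_cast

theorem diag_apply {A : Set Ω} (hA : MeasurableSet A) (x : E) :
    P.diag x A = ENNReal.ofReal (‖P.toFun A x‖ ^ 2) := by
  rw [diag, Measure.ofMeasurable_apply _ hA, P.inner_self_apply hA]
  rfl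

instance (x : E) : IsFiniteMeasure (P.diag x) :=
  ⟨by rw [P.diag_apply MeasurableSet.univ]; exact ENNReal.ofReal_lt_top⟩

theorem real_diag_apply {A : Set Ω} (hA : MeasurableSet A) (x : E) :
    (P.diag x).real A = ‖P.toFun A x‖ ^ 2 := by
  rw [measureReal_def, P.diag_apply hA, ENNReal.toReal_ofReal (sq_nonneg _)]

theorem real_diag_univ (x : E) : (P.diag x).real Set.univ = ‖x‖ ^ 2 := by
  rw [P.real_diag_apply MeasurableSet.univ, P.map_univ, one_apply_eq_self]

theorem map_biUnion_range {G : ℕ → Set Ω} (hG : ∀ n, MeasurableSet (G n))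
    (hd : Pairwise fun m n => Disjoint (G m) (G n)) (N : ℕ) :
    P.toFun (⋃ n ∈ Finset.range N, G n) = ∑ n ∈ Finset.range N, P.toFun (G n) := by
  induction N with
  | zero => simp [P.map_empty]
  | succ N ih =>
    rw [Finset.sum_range_succ, ← ih, ← P.map_union (Finset.measurableSet_biUnion _ fun n _ => hG n)
      (hG N)]
    · congr 1
      ext ω
      simp only [Finset.mem_range, Set.mem_iUnion, Set.mem_union, exists_prop, Nat.lt_succ_iff_lt_or_eq,
        or_and_right, exists_or, exists_eq_left]
    · simp only [Set.disjoint_iUnion_left, Finset.mem_range]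
      exact fun n hn => hd hn.ne

/-- A projection-valued measure is countably additive in the strong operator topology. -/
theorem tendsto_sum_apply {G : ℕ → Set Ω} (hG : ∀ n, MeasurableSet (G n))
    (hd : Pairwise fun m n => Disjoint (G m) (G n)) (x : E) :
    Tendsto (fun N => ∑ n ∈ Finset.range N, P.toFun (G n) x) atTop
      (𝓝 (P.toFun (⋃ n, G n) x)) := by
  set U := ⋃ n, G n with hU
  set A : ℕ → Set Ω := fun N => ⋃ n ∈ Finset.range N, G n with hA
  have hUm : MeasurableSet U := MeasurableSet.iUnion hG
  have hAm : ∀ N, MeasurableSet (A N) := fun N => Finset.measurableSet_biUnion _ fun n _ => hG n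
  have hAU : ∀ N, A N ⊆ U := fun N => Set.iUnion₂_subset fun n _ => Set.subset_iUnion G n
  have hmono : Monotone A := fun m n hmn =>
    Set.biUnion_subset_biUnion_left fun i hi => Finset.range_mono hmn hi
  have hUA : ⋃ N, A N = U := by
    refine Set.Subset.antisymm (Set.iUnion_subset hAU) (Set.iUnion_subset fun n => ?_)
    exact (Set.subset_biUnion_of_mem (u := G) (Finset.self_mem_range_succ n)).trans
      (Set.subset_iUnion A (n + 1))
  -- Weak additivity becomes strong because `‖P(U \ A N) x‖²` is the value of the finite measure
  -- `P.diag x` on `U \ A N`.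
  have hreal : Tendsto (fun N => (P.diag x).real (U \ A N)) atTop (𝓝 0) := by
    have h := tendsto_measure_iUnion_atTop (μ := P.diag x) hmono
    rw [hUA] at h
    have h2 := ((ENNReal.tendsto_toReal (measure_ne_top _ _)).comp h).const_sub
      ((P.diag x).real U)
    rw [← measureReal_def, sub_self] at h2
    refine h2.congr fun N => ?_
    rw [measureReal_sdiff (hAU N) (hAm N)]
    rfl
  rw [tendsto_iff_norm_sub_tendsto_zero]
  have h3 := (Real.continuous_sqrt.tendsto 0).comp hreal
  rw [Real.sqrt_zero] at h3
  refine h3.congr fun N => ?_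
  have h4 : P.toFun U = P.toFun (A N) + P.toFun (U \ A N) := by
    rw [← P.map_union (hAm N) (hUm.diff (hAm N)) Set.disjoint_sdiff_right,
      Set.union_sdiff_cancel (hAU N)]
  rw [Function.comp_apply, P.real_diag_apply (hUm.diff (hAm N)), Real.sqrt_sq (norm_nonneg _),
    h4, add_apply, P.map_biUnion_range hG hd, sum_apply, norm_sub_rev, add_sub_cancel_left]

/-- The integral of a simple function with respect to a projection-valued measure. -/
def simpleIntegral (f : SimpleFunc Ω ℂ) : E →L[ℂ] E :=
  ∑ c ∈ f.range, c • P.toFun (f ⁻¹' {c})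

theorem simpleIntegral_sub (f g : SimpleFunc Ω ℂ) :
    P.simpleIntegral (f - g) = P.simpleIntegral f - P.simpleIntegral g := by
  -- Under the zero measure no finiteness condition remains, so this is plain finite additivity of
  -- `s ↦ (c ↦ c • P(s))`.
  have h : FinMeasAdditive (0 : Measure Ω)
      fun s => (toSpanSingleton ℂ (P.toFun s)).restrictScalars ℝ := by
    intro s t hs ht _ _ hd
    ext1 c
    simp [P.map_union hs ht hd]
  have hi : ∀ f : SimpleFunc Ω ℂ, Integrable f (0 : Measure Ω) := fun f =>
    SimpleFunc.integrable_of_isFiniteMeasure f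
  have := SimpleFunc.setToSimpleFunc_sub _ h (hi f) (hi g)
  simpa [SimpleFunc.setToSimpleFunc, simpleIntegral] using this

/-- Distinct level sets have orthogonal ranges, so Pythagoras makes `f ↦ P(f) x` isometric for the
norm of `L²(P.diag x)`. -/
theorem norm_simpleIntegral_sq (f : SimpleFunc Ω ℂ) (x : E) :
    ‖P.simpleIntegral f x‖ ^ 2 = ∫ ω, ‖f ω‖ ^ 2 ∂(P.diag x) := by
  have hint := SimpleFunc.integrable_of_isFiniteMeasure (μ := P.diag x) f
  have h1 := SimpleFunc.map_integral f (fun z : ℂ => ‖z‖ ^ 2) hint (by simp)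
  rw [SimpleFunc.integral_eq_integral _ (SimpleFunc.integrable_of_isFiniteMeasure _)] at h1
  simp only [SimpleFunc.map_apply] at h1
  rw [h1, simpleIntegral, sum_apply, norm_sum_sq_of_pairwise_inner_eq_zero]
  · refine Finset.sum_congr rfl fun c _ => ?_
    rw [P.real_diag_apply (f.measurableSet_fiber c), smul_apply, norm_smul, mul_pow, smul_eq_mul,
      mul_comm]
  · intro c _ d _ hcd
    rw [smul_apply, smul_apply, inner_smul_left, inner_smul_right,
      P.inner_apply_eq_zero_of_disjoint (f.measurableSet_fiber c) (f.measurableSet_fiber d),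
      mul_zero, mul_zero]
    exact Disjoint.preimage _ (Set.disjoint_singleton.2 hcd)

theorem inner_simpleIntegral (f : SimpleFunc Ω ℂ) (x : E) :
    ⟪x, P.simpleIntegral f x⟫_ℂ = ∫ ω, f ω ∂(P.diag x) := by
  rw [← SimpleFunc.integral_eq_integral _ (SimpleFunc.integrable_of_isFiniteMeasure _),
    SimpleFunc.integral_eq, simpleIntegral, sum_apply, inner_sum]
  refine Finset.sum_congr rfl fun c _ => ?_
  rw [smul_apply, inner_smul_right, P.inner_self_apply (f.measurableSet_fiber c),
    P.real_diag_apply (f.measurableSet_fiber c), Complex.real_smul, mul_comm]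

/-- Approaching the infimum along a sequence of admissible bounds leaves only countably many null
sets. -/
theorem ae_enorm_le_essNorm {φ : Ω → ℂ} (hφ : Measurable φ) (x : E) :
    ∀ᵐ ω ∂(P.diag x), ‖φ ω‖ₑ ≤ P.essNorm φ := by
  have hne : {c : ℝ≥0∞ | P.toFun {ω | c < ‖φ ω‖ₑ} = 0}.Nonempty :=
    ⟨⊤, by simp [P.map_empty]⟩
  obtain ⟨u, -, hu, hmem⟩ := exists_seq_tendsto_sInf hne (OrderBot.bddBelow _)
  have h : ∀ᵐ ω ∂(P.diag x), ∀ n, ‖φ ω‖ₑ ≤ u n := by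
    refine ae_all_iff.2 fun n => ?_
    have hm : MeasurableSet {ω | u n < ‖φ ω‖ₑ} := measurableSet_lt measurable_const hφ.enorm
    have h0 : P.diag x {ω | u n < ‖φ ω‖ₑ} = 0 := by
      rw [P.diag_apply hm, show P.toFun {ω | u n < ‖φ ω‖ₑ} = 0 from hmem n]
      simp
    rw [ae_iff]
    simpa only [not_le] using h0
  filter_upwards [h] with ω hω
  exact ge_of_tendsto' hu hω

theorem ae_norm_le_essNorm {φ : Ω → ℂ} (hφ : Measurable φ) (hb : P.essNorm φ < ⊤) (x : E) :
    ∀ᵐ ω ∂(P.diag x), ‖φ ω‖ ≤ (P.essNorm φ).toReal := by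
  filter_upwards [P.ae_enorm_le_essNorm hφ x] with ω hω
  rw [← toReal_enorm]
  exact ENNReal.toReal_mono hb.ne hω

/-- On a complex space the quadratic form `⟪x, T x⟫` determines `T`. -/
theorem IsIntegral.unique {P : ProjValuedMeasure Ω E} {φ : Ω → ℂ} {T T' : E →L[ℂ] E}
    (h : P.IsIntegral φ T) (h' : P.IsIntegral φ T') : T = T' := by
  refine ContinuousLinearMap.coe_injective ((ext_inner_map _ _).1 fun x => ?_)
  have := (h x).2.trans (h' x).2.symm
  have h2 := congrArg (starRingEnd ℂ) this
  rwa [inner_conj_symm, inner_conj_symm] at h2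

theorem IsIntegral.integral_eq {P : ProjValuedMeasure Ω E} {φ : Ω → ℂ} {T : E →L[ℂ] E}
    (h : P.IsIntegral φ T) : P.integral φ = T := by
  have hex : ∃ T, P.IsIntegral φ T := ⟨T, h⟩
  rw [integral, dif_pos hex]
  exact hex.choose_spec.unique h

/-- By the isometry, dominated convergence in `L²(P.diag x)` makes `P(f n) x` Cauchy, and the limit
satisfies `‖T x‖² = ∫ |φ|² ≤ M² ‖x‖²`. The domination hypothesis has the form that
`SimpleFunc.approxOn` supplies. -/
theorem exists_isIntegral_of_tendsto {φ : Ω → ℂ} (hφ : Measurable φ) (hb : P.essNorm φ < ⊤)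
    {f : ℕ → SimpleFunc Ω ℂ} (hf : ∀ ω, Tendsto (fun n => f n ω) atTop (𝓝 (φ ω)))
    (hle : ∀ n ω, ‖f n ω‖ ≤ ‖φ ω‖ + ‖φ ω‖) :
    ∃ T : E →L[ℂ] E, (∀ x, Tendsto (fun n => P.simpleIntegral (f n) x) atTop (𝓝 (T x))) ∧
      P.IsIntegral φ T ∧ ‖T‖ₑ ≤ P.essNorm φ := by
  set M := (P.essNorm φ).toReal with hM
  have hM0 : 0 ≤ M := ENNReal.toReal_nonneg
  have hφM : ∀ x, ∀ᵐ ω ∂(P.diag x), ‖φ ω‖ ≤ M := P.ae_norm_le_essNorm hφ hb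
  have hfM : ∀ x n, ∀ᵐ ω ∂(P.diag x), ‖f n ω‖ ≤ 2 * M := fun x n => by
    filter_upwards [hφM x] with ω hω
    linarith [hle n ω]
  have hφi : ∀ x, Integrable φ (P.diag x) := fun x =>
    Integrable.of_bound hφ.aestronglyMeasurable M (hφM x)
  have hfφ : ∀ n, Measurable fun ω => f n ω - φ ω := fun n => (f n).measurable.sub hφ
  have hfφM : ∀ x n, ∀ᵐ ω ∂(P.diag x), ‖f n ω - φ ω‖ ≤ 3 * M := fun x n => by
    filter_upwards [hφM x, hfM x n] with ω h1 h2
    linarith [norm_sub_le (f n ω) (φ ω)]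
  have hsqi : ∀ x n, Integrable (fun ω => ‖f n ω - φ ω‖ ^ 2) (P.diag x) := fun x n => by
    refine Integrable.of_bound ((hfφ n).norm.pow_const 2).aestronglyMeasurable ((3 * M) ^ 2) ?_
    filter_upwards [hfφM x n] with ω h1
    rw [norm_pow, norm_norm]
    gcongr
  have ha : ∀ x, Tendsto (fun n => ∫ ω, ‖f n ω - φ ω‖ ^ 2 ∂(P.diag x)) atTop (𝓝 0) := fun x => by
    have h := tendsto_integral_of_dominated_convergence (μ := P.diag x)
      (F := fun n ω => ‖f n ω - φ ω‖ ^ 2) (f := fun _ => (0 : ℝ)) (fun _ => (3 * M) ^ 2)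
      (fun n => ((hfφ n).norm.pow_const 2).aestronglyMeasurable) (integrable_const _)
      (fun n => by
        filter_upwards [hfφM x n] with ω h1
        rw [norm_pow, norm_norm]
        gcongr)
      (ae_of_all _ fun ω => by
        have := ((tendsto_iff_norm_sub_tendsto_zero.1 (hf ω)).pow 2)
        simpa using this)
    simpa using h
  have hcau : ∀ x, CauchySeq fun n => P.simpleIntegral (f n) x := fun x => by
    refine Metric.cauchySeq_iff.2 fun ε hε => ?_
    -- The threshold `ε ^ 2 / 4` fits `|a - b|² ≤ 2|a|² + 2|b|²`, used for the difference of two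
    -- approximants.
    obtain ⟨N, hN⟩ := eventually_atTop.1 ((ha x).eventually_lt_const
      (show (0 : ℝ) < ε ^ 2 / 4 by positivity))
    refine ⟨N, fun m hm n hn => ?_⟩
    rw [dist_eq_norm, ← sub_apply, ← simpleIntegral_sub]
    refine lt_of_pow_lt_pow_left₀ 2 hε.le ?_
    rw [norm_simpleIntegral_sq]
    calc ∫ ω, ‖(f m - f n) ω‖ ^ 2 ∂(P.diag x)
        ≤ ∫ ω, (2 * ‖f m ω - φ ω‖ ^ 2 + 2 * ‖f n ω - φ ω‖ ^ 2) ∂(P.diag x) := by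
          refine integral_mono_of_nonneg (ae_of_all _ fun ω => sq_nonneg _)
            (((hsqi x m).const_mul 2).add ((hsqi x n).const_mul 2)) (ae_of_all _ fun ω => ?_)
          have h1 : ‖(f m - f n) ω‖ ≤ ‖f m ω - φ ω‖ + ‖f n ω - φ ω‖ := by
            rw [SimpleFunc.sub_apply, ← sub_sub_sub_cancel_right _ _ (φ ω)]
            exact norm_sub_le _ _
          have h2 := pow_le_pow_left₀ (norm_nonneg _) h1 2
          change ‖(f m - f n) ω‖ ^ 2 ≤ _
          nlinarith [sq_nonneg (‖f m ω - φ ω‖ - ‖f n ω - φ ω‖)]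
      _ = 2 * ∫ ω, ‖f m ω - φ ω‖ ^ 2 ∂(P.diag x) + 2 * ∫ ω, ‖f n ω - φ ω‖ ^ 2 ∂(P.diag x) := by
          rw [integral_add ((hsqi x m).const_mul 2) ((hsqi x n).const_mul 2),
            integral_const_mul, integral_const_mul]
      _ < ε ^ 2 := by linarith [hN m hm, hN n hn]
  choose T₀ hT₀ using fun x => cauchySeq_tendsto_of_complete (hcau x)
  have hnorm : ∀ x, ‖T₀ x‖ ≤ M * ‖x‖ := fun x => by
    refine le_of_sq_le_sq ?_ (by positivity)
    have h1 : Tendsto (fun n => ∫ ω, ‖f n ω‖ ^ 2 ∂(P.diag x)) atTop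
        (𝓝 (∫ ω, ‖φ ω‖ ^ 2 ∂(P.diag x))) := by
      refine tendsto_integral_of_dominated_convergence (fun _ => (2 * M) ^ 2)
        (fun n => ((f n).measurable.norm.pow_const 2).aestronglyMeasurable) (integrable_const _)
        (fun n => ?_) (ae_of_all _ fun ω => (hf ω).norm.pow 2)
      filter_upwards [hfM x n] with ω h1
      rw [norm_pow, norm_norm]
      gcongr
    have h2 := (hT₀ x).norm.pow 2
    simp only [norm_simpleIntegral_sq] at h2
    rw [tendsto_nhds_unique h2 h1, mul_pow, ← P.real_diag_univ x]
    calc ∫ ω, ‖φ ω‖ ^ 2 ∂(P.diag x) ≤ ∫ ω, M ^ 2 ∂(P.diag x) := by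
          refine integral_mono_of_nonneg (ae_of_all _ fun ω => sq_nonneg _) (integrable_const _) ?_
          filter_upwards [hφM x] with ω h1
          gcongr
      _ = M ^ 2 * (P.diag x).real Set.univ := by
          rw [integral_const, smul_eq_mul, mul_comm]
  let T : E →L[ℂ] E := LinearMap.mkContinuous
    (linearMapOfTendsto (l := atTop) T₀ (fun n => (P.simpleIntegral (f n) : E →ₗ[ℂ] E))
      (tendsto_pi_nhds.2 hT₀)) M hnorm
  refine ⟨T, hT₀, fun x => ⟨hφi x, ?_⟩, ?_⟩
  · have h1 : Tendsto (fun n => ∫ ω, f n ω ∂(P.diag x)) atTop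
        (𝓝 (∫ ω, φ ω ∂(P.diag x))) :=
      tendsto_integral_of_dominated_convergence (fun _ => 2 * M)
        (fun n => (f n).measurable.aestronglyMeasurable) (integrable_const _)
        (hfM x) (ae_of_all _ hf)
    have h2 : Tendsto (fun n => ⟪x, P.simpleIntegral (f n) x⟫_ℂ) atTop (𝓝 ⟪x, T x⟫_ℂ) :=
      tendsto_const_nhds.inner (hT₀ x)
    simp only [inner_simpleIntegral] at h2
    exact tendsto_nhds_unique h2 h1
  · rw [← ofReal_norm]
    exact (ENNReal.ofReal_le_ofReal (LinearMap.mkContinuous_norm_le _ hM0 hnorm)).trans_eq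
      (ENNReal.ofReal_toReal hb.ne)

theorem exists_isIntegral {φ : Ω → ℂ} (hφ : Measurable φ) (hb : P.essNorm φ < ⊤) :
    ∃ T : E →L[ℂ] E, P.IsIntegral φ T ∧ ‖T‖ₑ ≤ P.essNorm φ := by
  obtain ⟨T, -, h⟩ := P.exists_isIntegral_of_tendsto hφ hb
    (f := SimpleFunc.approxOn φ hφ Set.univ 0 (Set.mem_univ _))
    (fun ω => SimpleFunc.tendsto_approxOn hφ _ (by simp))
    (fun n ω => SimpleFunc.norm_approxOn_zero_le hφ _ ω n)
  exact ⟨T, h⟩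

theorem isIntegral_integral {φ : Ω → ℂ} (hφ : Measurable φ) (hb : P.essNorm φ < ⊤) :
    P.IsIntegral φ (P.integral φ) := by
  obtain ⟨T, hT, -⟩ := P.exists_isIntegral hφ hb
  rwa [hT.integral_eq]

theorem enorm_integral_le {φ : Ω → ℂ} (hφ : Measurable φ) (hb : P.essNorm φ < ⊤) :
    ‖P.integral φ‖ₑ ≤ P.essNorm φ := by
  obtain ⟨T, hT, h⟩ := P.exists_isIntegral hφ hb
  rwa [hT.integral_eq]

theorem tendsto_simpleIntegral {φ : Ω → ℂ} (hφ : Measurable φ) (hb : P.essNorm φ < ⊤)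
    {f : ℕ → SimpleFunc Ω ℂ} (hf : ∀ ω, Tendsto (fun n => f n ω) atTop (𝓝 (φ ω)))
    (hle : ∀ n ω, ‖f n ω‖ ≤ ‖φ ω‖ + ‖φ ω‖) (x : E) :
    Tendsto (fun n => P.simpleIntegral (f n) x) atTop (𝓝 (P.integral φ x)) := by
  obtain ⟨T, h, hT, -⟩ := P.exists_isIntegral_of_tendsto hφ hb hf hle
  rw [hT.integral_eq]
  exact h x

/-- Conjugating the quadratic form suffices, by uniqueness. Measurability of adjoint families
thereby reduces to that of the families themselves. -/
theorem adjoint_integral {φ : Ω → ℂ} (hφ : Measurable φ) (hb : P.essNorm φ < ⊤) :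
    adjoint (P.integral φ) = P.integral fun ω => starRingEnd ℂ (φ ω) := by
  refine (IsIntegral.integral_eq fun x => ?_).symm
  obtain ⟨h1, h2⟩ := P.isIntegral_integral hφ hb x
  refine ⟨?_, ?_⟩
  · exact (LinearIsometryEquiv.integrable_comp_iff Complex.conjLIE).2 h1
  · rw [integral_conj, ← h2, adjoint_inner_right, inner_conj_symm]

theorem essNorm_conj (φ : Ω → ℂ) : P.essNorm (fun ω => starRingEnd ℂ (φ ω)) = P.essNorm φ := by
  simp only [essNorm, RCLike.enorm_conj]

/-! ### Measurable dependence of the functional calculus on a parameter. -/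

variable {S : Type*} [MeasurableSpace S]

/-- A π-λ argument from measurable rectangles; the countable union step needs additivity in the
strong operator topology. -/
theorem stronglyMeasurable_slice {M : Set (Ω × S)} (hM : MeasurableSet M) (x : E) :
    StronglyMeasurable fun s => P.toFun {ω | (ω, s) ∈ M} x := by
  classical
  have hsl : ∀ {M : Set (Ω × S)}, MeasurableSet M → ∀ s, MeasurableSet {ω | (ω, s) ∈ M} :=
    fun hM s => measurable_prodMk_right hM
  induction M, hM using MeasurableSpace.induction_on_inter generateFrom_prod.symm
    isPiSystem_prod with
  | empty => simpa [P.map_empty] using stronglyMeasurable_const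
  | basic M hM =>
    obtain ⟨A, hA, B, hB, rfl⟩ := hM
    have h : (fun s => P.toFun {ω | (ω, s) ∈ A ×ˢ B} x) = B.indicator fun _ => P.toFun A x := by
      ext1 s
      by_cases hs : s ∈ B <;> simp [hs, P.map_empty]
    rw [h]
    exact stronglyMeasurable_const.indicator hB
  | compl M hM ih =>
    have h : ∀ s, P.toFun {ω | (ω, s) ∈ Mᶜ} x = x - P.toFun {ω | (ω, s) ∈ M} x := fun s => by
      rw [show {ω | (ω, s) ∈ Mᶜ} = {ω | (ω, s) ∈ M}ᶜ from rfl, P.map_compl (hsl hM s), sub_apply,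
        one_apply_eq_self]
    simp only [h]
    exact stronglyMeasurable_const.sub ih
  | iUnion M hd hM ih =>
    refine stronglyMeasurable_of_tendsto atTop
      (f := fun N s => ∑ n ∈ Finset.range N, P.toFun {ω | (ω, s) ∈ M n} x)
      (fun N => Finset.stronglyMeasurable_fun_sum _ fun n _ => ih n)
      (tendsto_pi_nhds.2 fun s => ?_)
    have h := P.tendsto_sum_apply (G := fun n => {ω | (ω, s) ∈ M n}) (fun n => hsl (hM n) s)
      (fun m n hmn => Set.disjoint_left.2 fun ω h1 h2 => Set.disjoint_left.1 (hd hmn) h1 h2) x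
    have hU : {ω | (ω, s) ∈ ⋃ n, M n} = ⋃ n, {ω | (ω, s) ∈ M n} := by ext; simp
    rwa [hU]

/-- Summing over the range of `f`, not of its slice, makes the index set independent of `s`; the
extra level sets are empty. -/
theorem simpleIntegral_slice (f : SimpleFunc (Ω × S) ℂ) (s : S) :
    P.simpleIntegral (f.comp (fun ω => (ω, s)) measurable_prodMk_right)
      = ∑ c ∈ f.range, c • P.toFun {ω | (ω, s) ∈ f ⁻¹' {c}} := by
  refine Finset.sum_subset (SimpleFunc.range_comp_subset_range f measurable_prodMk_right)
    fun c _ hc => ?_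
  have h : (f.comp (fun ω => (ω, s)) measurable_prodMk_right) ⁻¹' {c} = ∅ :=
    SimpleFunc.preimage_eq_empty_iff _ _ |>.2 hc
  rw [h, P.map_empty, smul_zero]

theorem stronglyMeasurable_integral {φ : Ω → S → ℂ}
    (hφ : Measurable fun p : Ω × S => φ p.1 p.2)
    (hb : ∀ s, P.essNorm (fun ω => φ ω s) < ⊤) (x : E) :
    StronglyMeasurable fun s => P.integral (fun ω => φ ω s) x := by
  set f := SimpleFunc.approxOn _ hφ Set.univ 0 (Set.mem_univ _) with hf
  refine stronglyMeasurable_of_tendsto atTop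
    (f := fun n s => P.simpleIntegral ((f n).comp (fun ω => (ω, s)) measurable_prodMk_right) x)
    (fun n => ?_) (tendsto_pi_nhds.2 fun s => ?_)
  · simp only [simpleIntegral_slice, sum_apply, smul_apply]
    exact Finset.stronglyMeasurable_fun_sum _ fun c _ =>
      (P.stronglyMeasurable_slice ((f n).measurableSet_fiber c) x).const_smul c
  · exact P.tendsto_simpleIntegral (hφ.comp measurable_prodMk_right) (hb s)
      (fun ω => SimpleFunc.tendsto_approxOn hφ (x := (ω, s)) (Set.mem_univ _) (by simp))
      (fun n ω => SimpleFunc.norm_approxOn_zero_le hφ (Set.mem_univ _) (ω, s) n) x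

theorem stronglyMeasurable_adjoint_integral {φ : Ω → S → ℂ}
    (hφ : Measurable fun p : Ω × S => φ p.1 p.2)
    (hb : ∀ s, P.essNorm (fun ω => φ ω s) < ⊤) (x : E) :
    StronglyMeasurable fun s => adjoint (P.integral fun ω => φ ω s) x := by
  have h : ∀ s, Measurable fun ω => φ ω s := fun s => hφ.comp measurable_prodMk_right
  simp only [fun s => P.adjoint_integral (h s) (hb s)]
  exact P.stronglyMeasurable_integral (φ := fun ω s => starRingEnd ℂ (φ ω s))
    (Complex.continuous_conj.measurable.comp hφ)
    (fun s => (P.essNorm_conj _).trans_lt (hb s)) x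

end ProjValuedMeasure

/-! ### Strongly measurable operator families and their action on `S₁`. -/

section StronglyMeasurableFamily

variable {S : Type*} [MeasurableSpace S]

/-- Along a simple approximation of `u` the value is a finite sum of indicators times `Φ s c`;
continuity of each `Φ s` passes to the limit. -/
theorem stronglyMeasurable_apply_of_continuous {X Y : Type*} [TopologicalSpace X]
    [NormedAddCommGroup Y] {Φ : S → X → Y} (hΦ : ∀ s, Continuous (Φ s))
    (hm : ∀ x, StronglyMeasurable fun s => Φ s x) {u : S → X} (hu : StronglyMeasurable u) :
    StronglyMeasurable fun s => Φ s (u s) := by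
  classical
  refine stronglyMeasurable_of_tendsto atTop (f := fun n s => Φ s (hu.approx n s)) (fun n => ?_)
    (tendsto_pi_nhds.2 fun s => ((hΦ s).tendsto _).comp (hu.tendsto_approx s))
  have h : (fun s => Φ s (hu.approx n s)) = fun s => ∑ c ∈ (hu.approx n).range,
      ((hu.approx n) ⁻¹' {c}).indicator (fun s => Φ s c) s := by
    ext1 s
    simp only [Set.indicator_apply, Set.mem_preimage, Set.mem_singleton_iff]
    rw [Finset.sum_ite_eq, if_pos (SimpleFunc.mem_range_self _ s)]
  rw [h]
  exact Finset.stronglyMeasurable_fun_sum _ fun c _ =>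
    (hm c).indicator ((hu.approx n).measurableSet_fiber c)

variable {E : Type*} [NormedAddCommGroup E] [InnerProductSpace ℂ E] [CompleteSpace E]
variable {F : Type*} [NormedAddCommGroup F] [InnerProductSpace ℂ F] [CompleteSpace F]
variable {G : Type*} [NormedAddCommGroup G] [InnerProductSpace ℂ G] [CompleteSpace G]

/-- A family of operators which is strongly measurable at each vector, together with its
pointwise adjoint. -/
structure StronglyMeasurableFamily (T : S → E →L[ℂ] F) : Prop where
  apply : ∀ x, StronglyMeasurable fun s => T s x
  adjoint : ∀ y, StronglyMeasurable fun s => adjoint (T s) y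

theorem StronglyMeasurableFamily.const (T : E →L[ℂ] F) :
    StronglyMeasurableFamily fun _ : S => T :=
  ⟨fun _ => stronglyMeasurable_const, fun _ => stronglyMeasurable_const⟩

theorem StronglyMeasurableFamily.comp {T : S → F →L[ℂ] G} {U : S → E →L[ℂ] F}
    (hT : StronglyMeasurableFamily T) (hU : StronglyMeasurableFamily U) :
    StronglyMeasurableFamily fun s => T s ∘L U s where
  apply x := stronglyMeasurable_apply_of_continuous (fun s => (T s).continuous) hT.apply
    (hU.apply x)
  adjoint y := by
    simp only [adjoint_comp, comp_apply]
    exact stronglyMeasurable_apply_of_continuous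
      (fun s => (ContinuousLinearMap.adjoint (U s)).continuous) hU.adjoint (hT.adjoint y)

namespace TraceClass

theorem stronglyMeasurable_rankOne {u : S → F} {v : S → E} (hu : StronglyMeasurable u)
    (hv : StronglyMeasurable v) : StronglyMeasurable fun s => rankOne (u s) (v s) :=
  (continuous_rankOne (E := E) (F := F)).comp_stronglyMeasurable (hu.prodMk hv)

/-- For constant `A`, rank one approximation reduces the claim to the vectors `B s (A e)`; a varying
`A` is then inserted by `stronglyMeasurable_apply_of_continuous`. -/
theorem stronglyMeasurable_compLeft {B : S → F →L[ℂ] G} (hB : StronglyMeasurableFamily B)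
    {A : S → TraceClass E F} (hA : StronglyMeasurable A) :
    StronglyMeasurable fun s => compLeft (B s) (A s) := by
  refine stronglyMeasurable_apply_of_continuous (fun s => (compLeft (B s)).continuous)
    (fun A => ?_) hA
  obtain ⟨t, ht⟩ := A.exists_tendsto_sum_rankOne
  have h : ∀ s, Tendsto (fun n => ∑ e ∈ t n, rankOne (B s (A.toCLM (stdBasis E e))) (stdBasis E e)) atTop
      (𝓝 (compLeft (B s) A)) := fun s => by
    have h := ((compLeft (B s)).continuous.tendsto A).comp ht
    simpa only [Function.comp_def, map_sum, compLeft_rankOne] using h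
  exact stronglyMeasurable_of_tendsto atTop
    (f := fun n s => ∑ e ∈ t n, rankOne (B s (A.toCLM (stdBasis E e))) (stdBasis E e))
    (fun n => Finset.stronglyMeasurable_fun_sum _ fun e _ =>
      stronglyMeasurable_rankOne (hB.apply _) stronglyMeasurable_const)
    (tendsto_pi_nhds.2 h)

/-- Right multiplication acts on the second vector of `|u⟩⟨v|` through the adjoint, which is why
families carry measurability of adjoints. -/
theorem stronglyMeasurable_compRight {C : S → G →L[ℂ] E} (hC : StronglyMeasurableFamily C)
    {A : S → TraceClass E F} (hA : StronglyMeasurable A) :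
    StronglyMeasurable fun s => compRight (C s) (A s) := by
  refine stronglyMeasurable_apply_of_continuous (fun s => (compRight (C s)).continuous)
    (fun A => ?_) hA
  obtain ⟨t, ht⟩ := A.exists_tendsto_sum_rankOne
  have h : ∀ s, Tendsto (fun n => ∑ e ∈ t n, rankOne (A.toCLM (stdBasis E e)) (adjoint (C s) (stdBasis E e))) atTop
      (𝓝 (compRight (C s) A)) := fun s => by
    have h := ((compRight (C s)).continuous.tendsto A).comp ht
    simpa only [Function.comp_def, map_sum, compRight_rankOne] using h
  exact stronglyMeasurable_of_tendsto atTop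
    (f := fun n s => ∑ e ∈ t n, rankOne (A.toCLM (stdBasis E e)) (adjoint (C s) (stdBasis E e)))
    (fun n => Finset.stronglyMeasurable_fun_sum _ fun e _ =>
      stronglyMeasurable_rankOne stronglyMeasurable_const (hC.adjoint _))
    (tendsto_pi_nhds.2 h)

theorem enorm_compLeft_le (B : F →L[ℂ] G) (A : TraceClass E F) :
    ‖compLeft B A‖ₑ ≤ ‖B‖ₑ * ‖A‖ₑ := by
  rw [enorm_def, enorm_def]
  exact traceNorm_comp_le_left _ _

theorem enorm_compRight_le (C : G →L[ℂ] E) (A : TraceClass E F) :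
    ‖compRight C A‖ₑ ≤ ‖C‖ₑ * ‖A‖ₑ := by
  rw [enorm_def, enorm_def]
  exact traceNorm_comp_le_right _ _

end TraceClass

end StronglyMeasurableFamily

/-! ### Bochner integrals as weak integrals. -/

section WeakIntegral

variable {S : Type*} [MeasurableSpace S] {ρ : Measure S}

theorem isGelfandPettisIntegral_integral {V : Type*} [NormedAddCommGroup V] [NormedSpace ℂ V]
    [CompleteSpace V] {f : S → V} (hf : Integrable f ρ) (G : Set S) :
    IsGelfandPettisIntegral ρ f G (∫ s in G, f s ∂ρ) := fun l =>
  (l.integral_comp_comm hf.integrableOn).symm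

/-- Strong measurability is assumed beyond Bochner integrability because weak integrability here
demands genuinely measurable functionals, not almost everywhere measurable ones. -/
theorem gelfandPettisIntegrable_of_integrable {V : Type*} [NormedAddCommGroup V]
    [NormedSpace ℂ V] [CompleteSpace V] {f : S → V} (hfm : StronglyMeasurable f)
    (hf : Integrable f ρ) : GelfandPettisIntegrable ρ f where
  measurable l := (l.continuous.comp_stronglyMeasurable hfm).measurable
  integrable l := l.integrable_comp hf
  exists_integral G _ := ⟨_, isGelfandPettisIntegral_integral hf G⟩

variable {E : Type*} [NormedAddCommGroup E] [InnerProductSpace ℂ E]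
variable {F : Type*} [NormedAddCommGroup F] [InnerProductSpace ℂ F]

theorem IsPettisIntegral.pettisIntegral_eq {f : S → E →L[ℂ] F} {T : E →L[ℂ] F}
    (h : IsPettisIntegral ρ f T) : pettisIntegral ρ f = T := by
  have hex : ∃ T, IsPettisIntegral ρ f T := ⟨T, h⟩
  rw [pettisIntegral, dif_pos hex]
  ext x
  exact ext_inner_left ℂ fun y => (hex.choose_spec.2 x y).trans (h.2 x y).symm

/-- Matrix coefficients are continuous functionals on `S₁`, being continuous for the weaker operator
norm. -/
theorem TraceClass.isPettisIntegral_toCLM [CompleteSpace E] [CompleteSpace F]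
    {A : S → TraceClass E F} (hAm : StronglyMeasurable A) (hA : Integrable A ρ) :
    IsPettisIntegral ρ (fun s => (A s).toCLM) (∫ s, A s ∂ρ).toCLM := by
  have h := gelfandPettisIntegrable_of_integrable hAm hA
  let l : E → F → TraceClass E F →L[ℂ] ℂ := fun x y =>
    innerSL ℂ y ∘L (ContinuousLinearMap.apply ℂ F x) ∘L inclusion E F
  exact ⟨⟨fun x y => h.measurable (l x y), fun x y => h.integrable (l x y)⟩,
    fun x y => ((l x y).integral_comp_comm hA).symm⟩

theorem exists_measurable_lintegral_lt_top {h : S → ℝ≥0∞} (hh : upperIntegral ρ h < ⊤) :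
    ∃ g : S → ℝ≥0∞, Measurable g ∧ h ≤ᵐ[ρ] g ∧ ∫⁻ s, g s ∂ρ < ⊤ := by
  simpa only [upperIntegral, iInf_lt_iff, exists_prop] using hh

end WeakIntegral

/-! ### The integrand of the multiple operator integral. -/

section MOI

variable {k : ℕ} {Ω : Fin (k + 1) → Type*} [∀ j, MeasurableSpace (Ω j)]
  {H : Fin (k + 1) → Type*} [∀ j, NormedAddCommGroup (H j)]
  [∀ j, InnerProductSpace ℂ (H j)] [∀ j, CompleteSpace (H j)]
  {S : Type*}
  (P : (j : Fin (k + 1)) → ProjValuedMeasure (Ω j) (H j))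
  (φs : (j : Fin (k + 1)) → Ω j → S → ℂ)
  (b : (j : Fin k) → H j.succ →L[ℂ] H j.castSucc)

/-- The initial segment of the product defining `moiIntegrand`, ending with the factor `j`. -/
def moiPartial (s : S) (j : Fin (k + 1)) : H j →L[ℂ] H 0 :=
  Fin.induction (motive := fun j => H j →L[ℂ] H 0)
    ((P 0).integral fun ω => φs 0 ω s)
    (fun j T => T ∘L b j ∘L (P j.succ).integral fun ω => φs j.succ ω s) j

theorem moiPartial_succ (s : S) (j : Fin k) :
    moiPartial P φs b s j.succ =
      moiPartial P φs b s j.castSucc ∘L b j ∘L (P j.succ).integral fun ω => φs j.succ ω s := rfl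

theorem prod_Iic_succ (N : Fin (k + 1) → ℝ≥0∞) (j : Fin k) :
    ∏ i ∈ Finset.Iic j.succ, N i = (∏ i ∈ Finset.Iic j.castSucc, N i) * N j.succ := by
  have h : Finset.Iic j.succ = insert j.succ (Finset.Iic j.castSucc) := by
    ext i
    simp only [Finset.mem_Iic, Finset.mem_insert, Fin.le_def, Fin.ext_iff, Fin.val_succ,
      Fin.val_castSucc]
    omega
  rw [h, Finset.prod_insert (by simp [Fin.le_def]), mul_comm]

variable {P φs} [MeasurableSpace S]

theorem stronglyMeasurableFamily_integral
    (hφ : ∀ j, Measurable fun p : Ω j × S => φs j p.1 p.2)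
    (hN : ∀ j s, (P j).essNorm (fun ω => φs j ω s) < ⊤) (j : Fin (k + 1)) :
    StronglyMeasurableFamily fun s => (P j).integral fun ω => φs j ω s :=
  ⟨(P j).stronglyMeasurable_integral (hφ j) (hN j),
    (P j).stronglyMeasurable_adjoint_integral (hφ j) (hN j)⟩

theorem enorm_integral_le_essNorm
    (hφ : ∀ j, Measurable fun p : Ω j × S => φs j p.1 p.2)
    (hN : ∀ j s, (P j).essNorm (fun ω => φs j ω s) < ⊤) (j : Fin (k + 1)) (s : S) :
    ‖(P j).integral fun ω => φs j ω s‖ₑ ≤ (P j).essNorm fun ω => φs j ω s :=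
  (P j).enorm_integral_le ((hφ j).comp measurable_prodMk_right) (hN j s)

theorem stronglyMeasurableFamily_moiPartial
    (hφ : ∀ j, Measurable fun p : Ω j × S => φs j p.1 p.2)
    (hN : ∀ j s, (P j).essNorm (fun ω => φs j ω s) < ⊤) (j : Fin (k + 1)) :
    StronglyMeasurableFamily fun s => moiPartial P φs b s j := by
  induction j using Fin.induction with
  | zero => exact stronglyMeasurableFamily_integral hφ hN 0
  | succ j ih =>
    exact ih.comp ((StronglyMeasurableFamily.const (b j)).comp
      (stronglyMeasurableFamily_integral hφ hN j.succ))

/-- The constant collects the norms of the `b` factors met so far and does not depend on `s`. -/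
theorem exists_enorm_moiPartial_le
    (hφ : ∀ j, Measurable fun p : Ω j × S => φs j p.1 p.2)
    (hN : ∀ j s, (P j).essNorm (fun ω => φs j ω s) < ⊤) (j : Fin (k + 1)) :
    ∃ C : ℝ≥0∞, C < ⊤ ∧ ∀ s, ‖moiPartial P φs b s j‖ₑ ≤
      C * ∏ i ∈ Finset.Iic j, (P i).essNorm fun ω => φs i ω s := by
  induction j using Fin.induction with
  | zero =>
    refine ⟨1, ENNReal.one_lt_top, fun s => ?_⟩
    have h : Finset.Iic (0 : Fin (k + 1)) = {0} := by ext i; simp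
    rw [h, Finset.prod_singleton, one_mul]
    exact enorm_integral_le_essNorm hφ hN 0 s
  | succ j ih =>
    obtain ⟨C, hC, h⟩ := ih
    refine ⟨C * ‖b j‖ₑ, ENNReal.mul_lt_top hC enorm_lt_top, fun s => ?_⟩
    rw [moiPartial_succ, prod_Iic_succ]
    calc _ ≤ ‖moiPartial P φs b s j.castSucc‖ₑ * (‖b j‖ₑ *
            ‖(P j.succ).integral fun ω => φs j.succ ω s‖ₑ) :=
          (opENorm_comp_le _ _).trans (by gcongr; exact opENorm_comp_le _ _)
      _ ≤ (C * ∏ i ∈ Finset.Iic j.castSucc, (P i).essNorm fun ω => φs i ω s) * (‖b j‖ₑ *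
            (P j.succ).essNorm fun ω => φs j.succ ω s) := by
          gcongr
          · exact h s
          · exact enorm_integral_le_essNorm hφ hN _ s
      _ = _ := by ring

/-- Once the trace class factor has entered the product, every further factor acts by right
multiplication on `S₁`, which preserves strong measurability and multiplies the bound. -/
theorem exists_traceClass_moiPartial
    (hφ : ∀ j, Measurable fun p : Ω j × S => φs j p.1 p.2)
    (hN : ∀ j s, (P j).essNorm (fun ω => φs j ω s) < ⊤) {i : Fin k}
    (hi : traceNorm (b i) < ⊤) (j : Fin (k + 1)) (hij : i.castSucc < j) :
    ∃ A : S → TraceClass (H j) (H 0), StronglyMeasurable A ∧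
      (∀ s, (A s).toCLM = moiPartial P φs b s j) ∧
      ∃ C : ℝ≥0∞, C < ⊤ ∧ ∀ s, ‖A s‖ₑ ≤
        C * ∏ i ∈ Finset.Iic j, (P i).essNorm fun ω => φs i ω s := by
  induction j using Fin.induction with
  | zero => exact absurd hij (Fin.not_lt_zero _)
  | succ j ih =>
    have hP := stronglyMeasurableFamily_integral hφ hN j.succ
    rcases (Fin.castSucc_lt_succ_iff.1 hij).eq_or_lt with rfl | hlt
    -- Here `b i` has just entered: the prefix before it is controlled in operator norm only, and
    -- multiplies the constant `S₁`-valued map `b i` from the left.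
    · obtain ⟨C, hC, h⟩ := exists_enorm_moiPartial_le b hφ hN i.castSucc
      refine ⟨fun s => TraceClass.compRight ((P i.succ).integral fun ω => φs i.succ ω s)
        (TraceClass.compLeft (moiPartial P φs b s i.castSucc) (TraceClass.mk (b i) hi)),
        TraceClass.stronglyMeasurable_compRight hP (TraceClass.stronglyMeasurable_compLeft
          (stronglyMeasurableFamily_moiPartial b hφ hN _) stronglyMeasurable_const),
        fun s => rfl, C * ‖TraceClass.mk (b i) hi‖ₑ, ENNReal.mul_lt_top hC enorm_lt_top,
        fun s => ?_⟩
      rw [prod_Iic_succ]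
      calc _ ≤ ‖(P i.succ).integral fun ω => φs i.succ ω s‖ₑ *
              (‖moiPartial P φs b s i.castSucc‖ₑ * ‖TraceClass.mk (b i) hi‖ₑ) :=
            (TraceClass.enorm_compRight_le _ _).trans
              (by gcongr; exact TraceClass.enorm_compLeft_le _ _)
        _ ≤ ((P i.succ).essNorm fun ω => φs i.succ ω s) *
              ((C * ∏ i ∈ Finset.Iic i.castSucc, (P i).essNorm fun ω => φs i ω s) *
                ‖TraceClass.mk (b i) hi‖ₑ) := by
            gcongr
            · exact enorm_integral_le_essNorm hφ hN _ s
            · exact h s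
        _ = _ := by ring
    · obtain ⟨A, hA, hAeq, C, hC, h⟩ := ih (Fin.castSucc_lt_castSucc_iff.2 hlt)
      refine ⟨fun s => TraceClass.compRight ((P j.succ).integral fun ω => φs j.succ ω s)
        (TraceClass.compRight (b j) (A s)),
        TraceClass.stronglyMeasurable_compRight hP (TraceClass.stronglyMeasurable_compRight
          (StronglyMeasurableFamily.const (b j)) hA),
        fun s => ?_, C * ‖b j‖ₑ, ENNReal.mul_lt_top hC enorm_lt_top, fun s => ?_⟩
      · rw [TraceClass.toCLM_compRight, TraceClass.toCLM_compRight, hAeq, moiPartial_succ,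
          comp_assoc]
      rw [prod_Iic_succ]
      calc _ ≤ ‖(P j.succ).integral fun ω => φs j.succ ω s‖ₑ * (‖b j‖ₑ * ‖A s‖ₑ) :=
            (TraceClass.enorm_compRight_le _ _).trans
              (by gcongr; exact TraceClass.enorm_compRight_le _ _)
        _ ≤ ((P j.succ).essNorm fun ω => φs j.succ ω s) * (‖b j‖ₑ *
              (C * ∏ i ∈ Finset.Iic j.castSucc, (P i).essNorm fun ω => φs i ω s)) := by
            gcongr
            · exact enorm_integral_le_essNorm hφ hN _ s
            · exact h s
        _ = _ := by ring

/-- If some `b j` is trace class, the integrand of the multiple operator integral is a Bochner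
integrable map into the trace class operators. -/
theorem IsIPD.exists_integrable_traceClass {φ : ((j : Fin (k + 1)) → Ω j) → ℂ} {ρ : Measure S}
    (hφ : IsIPD P φ ρ φs) (hb : ∃ j, traceNorm (b j) < ⊤) :
    ∃ A : S → TraceClass (H (Fin.last k)) (H 0), StronglyMeasurable A ∧ Integrable A ρ ∧
      ∀ s, (A s).toCLM = moiIntegrand P φs b s := by
  obtain ⟨i, hi⟩ := hb
  obtain ⟨A, hA, hAeq, C, hC, h⟩ := exists_traceClass_moiPartial b hφ.measurable
    hφ.essNorm_lt_top hi (Fin.last k) (Fin.castSucc_lt_last i)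
  obtain ⟨g, hgm, hg, hgi⟩ := exists_measurable_lintegral_lt_top hφ.upperIntegral_lt_top
  refine ⟨A, hA, ⟨hA.aestronglyMeasurable, ?_⟩, hAeq⟩
  calc ∫⁻ s, ‖A s‖ₑ ∂ρ ≤ ∫⁻ s, C * g s ∂ρ := by
        refine lintegral_mono_ae ?_
        filter_upwards [hg] with s hs
        refine (h s).trans ?_
        have huniv : Finset.Iic (Fin.last k) = Finset.univ := by
          ext i
          simp [Fin.le_last]
        rw [huniv]
        gcongr
    _ = C * ∫⁻ s, g s ∂ρ := lintegral_const_mul _ hgm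
    _ < ⊤ := ENNReal.mul_lt_top hC hgi

end MOI

end OpInt

end

theorem theorem4p11 {k : ℕ}
    {Ω : Fin (k + 1) → Type*} [∀ j, MeasurableSpace (Ω j)]
    {H : Fin (k + 1) → Type*} [∀ j, NormedAddCommGroup (H j)]
    [∀ j, InnerProductSpace ℂ (H j)] [∀ j, CompleteSpace (H j)]
    (P : (j : Fin (k + 1)) → OpInt.ProjValuedMeasure (Ω j) (H j))
    (φ : ((j : Fin (k + 1)) → Ω j) → ℂ)
    {S : Type*} [MeasurableSpace S] (ρ : Measure S)
    (φs : (j : Fin (k + 1)) → Ω j → S → ℂ)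
    (hφ : OpInt.IsIPD P φ ρ φs)
    (b : (j : Fin k) → H j.succ →L[ℂ] H j.castSucc)
    (hb : ∃ j, OpInt.traceNorm (b j) < ⊤) :
    ∃ hF : ∀ s, OpInt.traceNorm (OpInt.moiIntegrand P φs b s) < ⊤,
      OpInt.GelfandPettisIntegrable ρ
          (fun s => OpInt.TraceClass.mk (OpInt.moiIntegrand P φs b s) (hF s)) ∧
        ∃ hI : OpInt.traceNorm (OpInt.multipleOperatorIntegral P ρ φs b) < ⊤,
          OpInt.IsGelfandPettisIntegral ρ
            (fun s => OpInt.TraceClass.mk (OpInt.moiIntegrand P φs b s) (hF s)) Set.univ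
            (OpInt.TraceClass.mk (OpInt.multipleOperatorIntegral P ρ φs b) hI) := by
  obtain ⟨A, hAm, hA, hAeq⟩ := hφ.exists_integrable_traceClass b hb
  have hF : ∀ s, OpInt.traceNorm (OpInt.moiIntegrand P φs b s) < ⊤ := fun s => by
    rw [← hAeq s]
    exact (A s).2
  have hFA : (fun s => OpInt.TraceClass.mk (OpInt.moiIntegrand P φs b s) (hF s)) = A :=
    funext fun s => OpInt.TraceClass.toCLM_injective (hAeq s).symm
  have hIA : OpInt.multipleOperatorIntegral P ρ φs b = (∫ s, A s ∂ρ).toCLM := by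
    -- The Bochner integral in `S₁` is a pointwise Pettis integral of the integrand, hence the only
    -- one.
    have h := OpInt.TraceClass.isPettisIntegral_toCLM hAm hA
    rw [funext hAeq] at h
    exact h.pettisIntegral_eq
  have hI : OpInt.traceNorm (OpInt.multipleOperatorIntegral P ρ φs b) < ⊤ := by
    rw [hIA]
    exact (∫ s, A s ∂ρ).2
  have hmk : OpInt.TraceClass.mk (OpInt.multipleOperatorIntegral P ρ φs b) hI = ∫ s, A s ∂ρ :=
    OpInt.TraceClass.toCLM_injective hIA
  refine ⟨hF, ?_, hI, ?_⟩
  · rw [hFA]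
    exact OpInt.gelfandPettisIntegrable_of_integrable hAm hA
  · rw [hFA, hmk, ← setIntegral_univ]
    exact OpInt.isGelfandPettisIntegral_integral hA Set.univ
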